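/- Let $d \ge 1$ be an integer. For $\tau > 0$ let $\gamma_\tau$ denote the centred Gaussian measure on $\mathbb{R}^d$ with density $(2\pi\tau)^{-d/2}\exp(-|x|^2/(2\tau))$, and write $\gamma = \gamma_1$; all $L^p$ spaces consist of complex-valued functions. Let $L$ be the Ornstein-Uhlenbeck operator on $L^2(\mathbb{R}^d,\gamma)$, i.e. the closure in $L^2(\mathbb{R}^d,\gamma)$ of the operator $\varphi \mapsto -\Delta\varphi + x\cdot\nabla\varphi$ with domain $C_{\mathrm c}^2(\mathbb{R}^d)$. Corollary (Restricted Sobolev embedding). Let $p\in(\frac{2d}{d+2},2]$ with $p \ge 1$. Then the operator $I+L$ has a bounded everywhere defined inverse $(I+L)^{-1}$ on $L^2(\mathbb{R}^d,\gamma)$, and this resolvent maps $L^p(\mathbb{R}^d,\gamma_{2/p})$ into $L^2(\mathbb{R}^d,\gamma)$: its restriction to $L^p(\mathbb{R}^d,\gamma_{2/p})\cap L^2(\mathbb{R}^d,\gamma)$ extends uniquely to a bounded linear operator from $L^p(\mathbb{R}^d,\gamma_{2/p})$ to $L^2(\mathbb{R}^d,\gamma)$. -/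

import Mathlib

open MeasureTheory InnerProductSpace

/-- The centred Gaussian measure `γ_τ` on `ℝ^d`, with density
`(2πτ)^{-d/2} exp (-|x|² / (2τ))` with respect to Lebesgue measure. -/
noncomputable def gaussMeasure (d : ℕ) (τ : ℝ) : Measure (EuclideanSpace ℝ (Fin d)) :=
  volume.withDensity fun x =>
    ENNReal.ofReal ((2 * Real.pi * τ) ^ (-(d : ℝ) / 2) * Real.exp (-‖x‖ ^ 2 / (2 * τ)))

/-- The complex Hilbert space `L²(ℝ^d, γ)`, where `γ = γ_1` is the standard Gaussian measure. -/
abbrev L2Gauss (d : ℕ) : Type :=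
  Lp ℂ 2 (gaussMeasure d 1)

/-- The complex space `L^p(ℝ^d, γ_τ)`. -/
abbrev LpGauss (d : ℕ) (p τ : ℝ) : Type :=
  Lp ℂ (ENNReal.ofReal p) (gaussMeasure d τ)

instance factOneLeOfReal (p : ℝ) [h : Fact (1 ≤ p)] : Fact (1 ≤ ENNReal.ofReal p) :=
  ⟨by simpa using h.out⟩

/-- The Ornstein-Uhlenbeck differential expression `-Δφ(x) + x · ∇φ(x)`. -/
noncomputable def ouExpr {d : ℕ} (φ : EuclideanSpace ℝ (Fin d) → ℂ)
    (x : EuclideanSpace ℝ (Fin d)) : ℂ :=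
  -(Laplacian.laplacian φ x) + fderiv ℝ φ x x

theorem ouExpr_add {d : ℕ} {φ ψ : EuclideanSpace ℝ (Fin d) → ℂ}
    (hφ : ContDiff ℝ 2 φ) (hψ : ContDiff ℝ 2 ψ) :
    ouExpr (φ + ψ) = ouExpr φ + ouExpr ψ := by
  funext x
  have h1 := hφ.contDiffAt.laplacian_add (x := x) hψ.contDiffAt
  have h2 := fderiv_add ((hφ.differentiable (by norm_num)) x)
    ((hψ.differentiable (by norm_num)) x)
  simp only [ouExpr, Pi.add_apply, h1, h2, add_apply]
  ring

theorem ouExpr_smul {d : ℕ} {φ : EuclideanSpace ℝ (Fin d) → ℂ} (c : ℂ)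
    (hφ : ContDiff ℝ 2 φ) : ouExpr (c • φ) = c • ouExpr φ := by
  funext x
  have h1 := laplacian_smul c (hφ.contDiffAt (x := x))
  have h2 := fderiv_const_smul ((hφ.differentiable (by norm_num)) x) c
  simp only [ouExpr, Pi.smul_apply, h1, h2, smul_apply, smul_eq_mul]
  ring

/-- The graph `{(φ, Lφ) : φ ∈ C_c²(ℝ^d)}` in `L²(γ) × L²(γ)`, with `Lφ = -Δφ + x · ∇φ`. -/
noncomputable def ouGraph (d : ℕ) : Submodule ℂ (L2Gauss d × L2Gauss d) where
  carrier := {w | ∃ φ : EuclideanSpace ℝ (Fin d) → ℂ, ContDiff ℝ 2 φ ∧ HasCompactSupport φ ∧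
    w.1 =ᵐ[gaussMeasure d 1] φ ∧ w.2 =ᵐ[gaussMeasure d 1] ouExpr φ}
  zero_mem' := by
    refine ⟨0, contDiff_const, HasCompactSupport.zero, Lp.coeFn_zero _ _ _, ?_⟩
    have h : ouExpr (0 : EuclideanSpace ℝ (Fin d) → ℂ) = 0 := by
      simpa using ouExpr_smul (d := d) (φ := 0) 0 contDiff_const
    rw [h]
    exact Lp.coeFn_zero _ _ _
  add_mem' := by
    rintro a b ⟨φ, h1, h2, h3, h4⟩ ⟨ψ, k1, k2, k3, k4⟩
    refine ⟨φ + ψ, h1.add k1, h2.add k2, (Lp.coeFn_add _ _).trans (h3.add k3), ?_⟩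
    rw [ouExpr_add h1 k1]
    exact (Lp.coeFn_add _ _).trans (h4.add k4)
  smul_mem' := by
    rintro c a ⟨φ, h1, h2, h3, h4⟩
    refine ⟨c • φ, contDiff_const.smul h1, h2.smul_left (f := fun _ => c),
      (Lp.coeFn_smul _ _).trans (h3.const_smul c), ?_⟩
    rw [ouExpr_smul c h1]
    exact (Lp.coeFn_smul _ _).trans (h4.const_smul c)

theorem volume_absolutelyContinuous_gaussMeasure (d : ℕ) {τ : ℝ} (hτ : 0 < τ) :
    (volume : Measure (EuclideanSpace ℝ (Fin d))) ≪ gaussMeasure d τ := by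
  refine withDensity_absolutelyContinuous' ?_ (Filter.Eventually.of_forall fun x => ?_)
  · refine (ENNReal.measurable_ofReal.comp ?_).aemeasurable
    fun_prop
  · have h : 0 < (2 * Real.pi * τ) ^ (-(d : ℝ) / 2) * Real.exp (-‖x‖ ^ 2 / (2 * τ)) := by
      positivity
    simpa using h

/-- The set `ouGraph d` is the graph of a (single-valued) operator. -/
theorem ouGraph_snd_eq_zero (d : ℕ) (w : L2Gauss d × L2Gauss d) (hw : w ∈ ouGraph d)
    (h0 : w.1 = 0) : w.2 = 0 := by
  obtain ⟨φ, h1, -, h3, h4⟩ := hw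
  rw [h0] at h3
  have h5 : φ =ᵐ[gaussMeasure d 1] 0 := h3.symm.trans (Lp.coeFn_zero _ _ _)
  have h6 : φ =ᵐ[volume] 0 := (volume_absolutelyContinuous_gaussMeasure d one_pos).ae_eq h5
  have h7 : φ = 0 := (h1.continuous.ae_eq_iff_eq volume continuous_const).1 h6
  have h8 : ouExpr φ = 0 := by
    rw [h7]
    simpa using ouExpr_smul (d := d) (φ := 0) 0 contDiff_const
  rw [h8] at h4
  exact Lp.ext (h4.trans (Lp.coeFn_zero _ _ _).symm)

/-- The Ornstein-Uhlenbeck operator `L = -Δ + x · ∇` on `L²(γ)` with domain `C_c²(ℝ^d)`. -/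
noncomputable def ouCore (d : ℕ) : L2Gauss d →ₗ.[ℂ] L2Gauss d :=
  (ouGraph d).toLinearPMap

theorem ouCore_graph (d : ℕ) : (ouCore d).graph = ouGraph d :=
  Submodule.toLinearPMap_graph_eq _ (ouGraph_snd_eq_zero d)

/-- The Ornstein-Uhlenbeck operator `L` on `L²(γ)`: the closure of `-Δ + x · ∇` on `C_c²(ℝ^d)`. -/
noncomputable def ornsteinUhlenbeck (d : ℕ) : L2Gauss d →ₗ.[ℂ] L2Gauss d :=
  (ouCore d).closure

/-- The bounded operator `R` is `(I + A)⁻¹`: it maps into the domain of `A`,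
`(I + A) R = I`, and `R (I + A) = I` on the domain of `A`. -/
def IsResolventOneAdd {H : Type*} [NormedAddCommGroup H] [NormedSpace ℂ H]
    (A : H →ₗ.[ℂ] H) (R : H →L[ℂ] H) : Prop :=
  (∀ f : H, ∃ h : R f ∈ A.domain, R f + A ⟨R f, h⟩ = f) ∧
    ∀ u : A.domain, R ((u : H) + A u) = u

/-! Write `ρ` for the density of `γ_2`. Two facts carry the theorem: the resolvent `R = (I + L)⁻¹`
is symmetric, and `u ↦ ρ u` turns Gaussian estimates into Lebesgue ones.

Symmetry gives `‖R f‖² = ⟪f, R (R f)⟫`. It therefore suffices to prove the dual estimate `|⟪f, u⟫| ≤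
C ‖f‖_p ‖(I + L) u‖` for `u` in the domain of `L`, with `‖f‖_p` taken in `L^p(γ_{2/p})`
(`exists_norm_inner_le`). For `u = R (R f)` its last factor is `‖R f‖`, which cancels.

For the dual estimate, the density of `γ_1` is a multiple of `ρ²`, so `⟪f, u⟫` is a multiple of the
Lebesgue integral of the conjugate of `ρ f` times `ρ u`, and Hölder applies with `p` and its
conjugate `q`. Since `ρ^p` is a multiple of the density of `γ_{2/p}`, the factor `‖ρ f‖_{L^p(dx)}`
is a multiple of `‖f‖_p`. The other factor is bounded by the `H¹(dx)` norm of `ρ u`, because `p >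
2d/(d+2)` says exactly that `1/q > 1/2 - 1/d` (`exists_sobolev`). As `∇ρ = -(x/2) ρ`, that norm is
controlled by `u`, `∇u` and `|x| u` in `L²(γ)`. Gaussian integration by parts absorbs `|x| u` into
the first two (`integral_sq_coord_mul_norm_sq_le`), and the Dirichlet form bounds those by `‖(I + L)
u‖` (`exists_eLpNorm_sobolevDensity_le`).

The resolvent exists because `L` is symmetric and nonnegative on `C_c²`, whence `‖u‖ ≤ ‖u + L u‖`,
and because `(I + L) C_c²` is dense. For density, a function orthogonal to this range is also
orthogonal to `I + L` applied to plane waves, by cut-off. Along each ray this is a first-order ODE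
for a Fourier transform, and it forces that transform to vanish
(`ae_eq_zero_of_forall_integral_mul_add_ouExpr`). -/

open scoped ENNReal NNReal

/-! ### Gaussian measures -/

/-- The density of `gaussMeasure d τ`. -/
noncomputable def gaussDensity (d : ℕ) (τ : ℝ) (x : EuclideanSpace ℝ (Fin d)) : ℝ :=
  (2 * Real.pi * τ) ^ (-(d : ℝ) / 2) * Real.exp (-‖x‖ ^ 2 / (2 * τ))

theorem gaussMeasure_eq (d : ℕ) (τ : ℝ) :
    gaussMeasure d τ = volume.withDensity fun x => ENNReal.ofReal (gaussDensity d τ x) := rfl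

theorem gaussDensity_pos (d : ℕ) {τ : ℝ} (hτ : 0 < τ) (x : EuclideanSpace ℝ (Fin d)) :
    0 < gaussDensity d τ x := by
  unfold gaussDensity; positivity

theorem continuous_gaussDensity (d : ℕ) (τ : ℝ) : Continuous (gaussDensity d τ) := by
  unfold gaussDensity; fun_prop

theorem contDiff_gaussDensity (d : ℕ) (τ : ℝ) {n : WithTop ℕ∞} :
    ContDiff ℝ n (gaussDensity d τ) := by
  unfold gaussDensity
  exact contDiff_const.mul (((contDiff_norm_sq ℝ).neg.div_const _).exp)

theorem measurable_ofReal_gaussDensity (d : ℕ) (τ : ℝ) :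
    Measurable fun x => ENNReal.ofReal (gaussDensity d τ x) :=
  ENNReal.measurable_ofReal.comp (continuous_gaussDensity d τ).measurable

theorem gaussMeasure_absolutelyContinuous_volume (d : ℕ) (τ : ℝ) :
    gaussMeasure d τ ≪ (volume : Measure (EuclideanSpace ℝ (Fin d))) :=
  withDensity_absolutelyContinuous _ _

theorem integral_gaussMeasure {d : ℕ} {τ : ℝ} (hτ : 0 < τ) {F : Type*} [NormedAddCommGroup F]
    [NormedSpace ℝ F] (f : EuclideanSpace ℝ (Fin d) → F) :
    ∫ x, f x ∂gaussMeasure d τ = ∫ x, gaussDensity d τ x • f x := by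
  rw [gaussMeasure_eq, integral_withDensity_eq_integral_toReal_smul
    (measurable_ofReal_gaussDensity d τ) (by simp)]
  simp [ENNReal.toReal_ofReal (gaussDensity_pos d hτ _).le]

theorem integrable_gaussMeasure_iff {d : ℕ} {τ : ℝ} (hτ : 0 < τ) {F : Type*}
    [NormedAddCommGroup F] [NormedSpace ℝ F] {f : EuclideanSpace ℝ (Fin d) → F} :
    Integrable f (gaussMeasure d τ) ↔ Integrable fun x => gaussDensity d τ x • f x := by
  rw [gaussMeasure_eq, integrable_withDensity_iff_integrable_smul'
    (measurable_ofReal_gaussDensity d τ) (by simp)]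
  simp [ENNReal.toReal_ofReal (gaussDensity_pos d hτ _).le]

theorem integrable_exp_neg_mul_norm_sq (d : ℕ) {b : ℝ} (hb : 0 < b) :
    Integrable fun x : EuclideanSpace ℝ (Fin d) => Real.exp (-b * ‖x‖ ^ 2) := by
  have h := (GaussianFourier.integrable_cexp_neg_mul_sq_norm_add (b := (b : ℂ))
    (by simpa using hb) 0 (0 : EuclideanSpace ℝ (Fin d))).norm
  refine h.congr (Filter.Eventually.of_forall fun x => ?_)
  simp only [Complex.norm_exp]
  congr 1
  norm_cast
  simp

theorem integrable_norm_pow_gaussMeasure (d : ℕ) {τ : ℝ} (hτ : 0 < τ) (k : ℕ) :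
    Integrable (fun x => ‖x‖ ^ (2 * k)) (gaussMeasure d τ) := by
  rw [integrable_gaussMeasure_iff hτ]
  have h := ((integrable_exp_neg_mul_norm_sq d (b := 1 / (4 * τ)) (by positivity)).const_mul
    ((2 * Real.pi * τ) ^ (-(d : ℝ) / 2) * (4 * τ) ^ k * k.factorial))
  refine h.mono' ((continuous_gaussDensity d τ).smul
    (continuous_norm.pow _)).aestronglyMeasurable (Filter.Eventually.of_forall fun x => ?_)
  -- The power is paid for by half of the Gaussian exponent, through `t ^ k / k! ≤ exp t` with `t =
  -- ‖x‖² / (4τ)`; the other half keeps the majorant integrable.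
  have h1 := Real.pow_div_factorial_le_exp (‖x‖ ^ 2 / (4 * τ)) (by positivity) k
  rw [div_le_iff₀ (by positivity), div_pow, div_le_iff₀ (by positivity), ← pow_mul] at h1
  rw [smul_eq_mul, norm_mul, Real.norm_of_nonneg (gaussDensity_pos d hτ x).le,
    Real.norm_of_nonneg (by positivity), gaussDensity]
  have h2 : Real.exp (-‖x‖ ^ 2 / (2 * τ)) =
      Real.exp (-(1 / (4 * τ)) * ‖x‖ ^ 2) * Real.exp (-(‖x‖ ^ 2 / (4 * τ))) := by
    rw [← Real.exp_add]; congr 1; field_simp; ring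
  have h3 : Real.exp (-(‖x‖ ^ 2 / (4 * τ))) * Real.exp (‖x‖ ^ 2 / (4 * τ)) = 1 := by
    rw [← Real.exp_add]; simp
  rw [h2]
  calc _ ≤ (2 * Real.pi * τ) ^ (-(d : ℝ) / 2) *
        (Real.exp (-(1 / (4 * τ)) * ‖x‖ ^ 2) * Real.exp (-(‖x‖ ^ 2 / (4 * τ)))) *
        (Real.exp (‖x‖ ^ 2 / (4 * τ)) * k.factorial * (4 * τ) ^ k) := by gcongr
    _ = (2 * Real.pi * τ) ^ (-(d : ℝ) / 2) * (4 * τ) ^ k * k.factorial *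
        Real.exp (-(1 / (4 * τ)) * ‖x‖ ^ 2) *
        (Real.exp (-(‖x‖ ^ 2 / (4 * τ))) * Real.exp (‖x‖ ^ 2 / (4 * τ))) := by ring
    _ = _ := by rw [h3, mul_one]

theorem isFiniteMeasure_gaussMeasure (d : ℕ) {τ : ℝ} (hτ : 0 < τ) :
    IsFiniteMeasure (gaussMeasure d τ) := by
  have h := integrable_norm_pow_gaussMeasure d hτ 0
  simpa [integrable_const_iff] using h

instance isFiniteMeasure_gaussMeasure_one (d : ℕ) : IsFiniteMeasure (gaussMeasure d 1) :=
  isFiniteMeasure_gaussMeasure d one_pos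

theorem integrable_gaussMeasure_of_continuous {d : ℕ} {F : Type*} [NormedAddCommGroup F]
    {φ : EuclideanSpace ℝ (Fin d) → ℂ} (hφ : HasCompactSupport φ)
    {g : EuclideanSpace ℝ (Fin d) → F} (hg : Continuous g) (h : ∀ x, φ x = 0 → g x = 0) :
    Integrable g (gaussMeasure d 1) :=
  hg.integrable_of_hasCompactSupport (hφ.mono fun x hx h0 => hx (h x h0))

/-- A function bounded by a quadratic polynomial is in `L²(γ)`. -/
theorem memLp_two_of_norm_le {d : ℕ} {F : Type*} [NormedAddCommGroup F]
    {f : EuclideanSpace ℝ (Fin d) → F} {C : ℝ}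
    (hf : AEStronglyMeasurable f (gaussMeasure d 1)) (h : ∀ x, ‖f x‖ ≤ C * (1 + ‖x‖ ^ 2)) :
    MemLp f 2 (gaussMeasure d 1) := by
  have h1 : MemLp (fun x : EuclideanSpace ℝ (Fin d) => ‖x‖ ^ 2) 2 (gaussMeasure d 1) := by
    refine (memLp_two_iff_integrable_sq (by fun_prop)).2 ?_
    exact (integrable_norm_pow_gaussMeasure d one_pos 2).congr
      (Filter.Eventually.of_forall fun x => by simp only; ring)
  have h2 := ((memLp_const (p := 2) (μ := gaussMeasure d 1) (1 : ℝ)).add h1).const_mul C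
  exact h2.mono' hf (Filter.Eventually.of_forall h)

theorem hasFDerivAt_gaussDensity (d : ℕ) {τ : ℝ} (x : EuclideanSpace ℝ (Fin d)) :
    HasFDerivAt (gaussDensity d τ)
      (-(gaussDensity d τ x / τ) • innerSL ℝ x) x := by
  have h1 : HasFDerivAt (fun y : EuclideanSpace ℝ (Fin d) => -‖y‖ ^ 2 * (2 * τ)⁻¹)
      ((2 * τ)⁻¹ • (-((2 : ℕ) • innerSL ℝ x) : EuclideanSpace ℝ (Fin d) →L[ℝ] ℝ)) x :=
    (hasStrictFDerivAt_norm_sq x).hasFDerivAt.neg.mul_const (2 * τ)⁻¹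
  refine (h1.exp.const_mul ((2 * Real.pi * τ) ^ (-(d : ℝ) / 2))).congr_fderiv ?_
  ext y
  -- For `τ = 0`, division by zero makes the density constant and the claimed derivative zero.
  by_cases hτ : τ = 0
  · simp [hτ, gaussDensity]
  · simp [gaussDensity]
    field_simp

/-- Gaussian integration by parts. -/
theorem integral_gaussMeasure_fderiv {d : ℕ} {F : Type*} [NormedAddCommGroup F] [NormedSpace ℝ F]
    {h : EuclideanSpace ℝ (Fin d) → F}
    (hh : ContDiff ℝ 1 h) (hc : HasCompactSupport h) (v : EuclideanSpace ℝ (Fin d)) :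
    ∫ x, fderiv ℝ h x v ∂gaussMeasure d 1 = ∫ x, inner ℝ x v • h x ∂gaussMeasure d 1 := by
  rw [integral_gaussMeasure one_pos, integral_gaussMeasure one_pos]
  have hG := continuous_gaussDensity d 1
  have hGf : ∀ x, fderiv ℝ (gaussDensity d 1) x v = -gaussDensity d 1 x * inner ℝ x v := by
    intro x
    rw [(hasFDerivAt_gaussDensity d x).fderiv]
    simp
  have hd : Continuous fun x => fderiv ℝ h x v :=
    (hh.continuous_fderiv (by norm_num)).clm_apply continuous_const
  have h1 := integral_smul_fderiv_eq_neg_fderiv_smul_of_integrable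
    (μ := (volume : Measure (EuclideanSpace ℝ (Fin d)))) (f := gaussDensity d 1) (g := h) (v := v)
    ?_ ?_ ?_ ?_ ?_
  · rw [h1, ← integral_neg]
    congr 1 with x
    rw [hGf]
    simp [mul_smul]
  · simp only [hGf]
    refine Continuous.integrable_of_hasCompactSupport ?_ hc.smul_left
    fun_prop
  · exact (hG.smul hd).integrable_of_hasCompactSupport (hc.fderiv_apply ℝ v).smul_left
  · exact (hG.smul hh.continuous).integrable_of_hasCompactSupport hc.smul_left
  · exact fun x _ => (hasFDerivAt_gaussDensity d x).differentiableAt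
  · exact fun x _ => hh.differentiable (by norm_num) x

/-! ### The Dirichlet form -/

/-- The partial derivative of `φ` in the `i`-th coordinate direction. -/
noncomputable def partialDeriv {d : ℕ} (i : Fin d) (φ : EuclideanSpace ℝ (Fin d) → ℂ)
    (x : EuclideanSpace ℝ (Fin d)) : ℂ :=
  fderiv ℝ φ x (EuclideanSpace.single i 1)

section PartialDeriv

variable {d : ℕ} {φ ψ : EuclideanSpace ℝ (Fin d) → ℂ}

theorem contDiff_partialDeriv (hφ : ContDiff ℝ 2 φ) (i : Fin d) :
    ContDiff ℝ 1 (partialDeriv i φ) :=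
  (hφ.fderiv_right (m := 1) (by norm_num)).clm_apply contDiff_const

theorem continuous_partialDeriv (hφ : ContDiff ℝ 1 φ) (i : Fin d) :
    Continuous (partialDeriv i φ) :=
  (hφ.continuous_fderiv (by norm_num)).clm_apply continuous_const

theorem hasCompactSupport_partialDeriv (hφ : HasCompactSupport φ) (i : Fin d) :
    HasCompactSupport (partialDeriv i φ) :=
  hφ.fderiv_apply ℝ _

theorem fderiv_apply_eq_sum (x v : EuclideanSpace ℝ (Fin d)) :
    fderiv ℝ φ x v = ∑ i, v i • partialDeriv i φ x := by
  conv_lhs => rw [← (EuclideanSpace.basisFun (Fin d) ℝ).sum_repr v]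
  simp [map_sum, partialDeriv]

theorem laplacian_eq_sum (hφ : ContDiff ℝ 2 φ) (x : EuclideanSpace ℝ (Fin d)) :
    Laplacian.laplacian φ x = ∑ i, partialDeriv i (partialDeriv i φ) x := by
  rw [laplacian_eq_iteratedFDeriv_orthonormalBasis φ (EuclideanSpace.basisFun (Fin d) ℝ)]
  refine Finset.sum_congr rfl fun i _ => ?_
  have h : DifferentiableAt ℝ (fderiv ℝ φ) x :=
    (hφ.fderiv_right (m := 1) (by norm_num)).differentiable (by norm_num) x
  rw [iteratedFDeriv_two_apply]
  unfold partialDeriv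
  rw [fderiv_clm_apply h (differentiableAt_const _)]
  simp

theorem ouExpr_eq_sum (hφ : ContDiff ℝ 2 φ) (x : EuclideanSpace ℝ (Fin d)) :
    ouExpr φ x = ∑ i, (x i • partialDeriv i φ x - partialDeriv i (partialDeriv i φ) x) := by
  rw [ouExpr, laplacian_eq_sum hφ, fderiv_apply_eq_sum, Finset.sum_sub_distrib]
  ring

theorem continuous_ouExpr (hφ : ContDiff ℝ 2 φ) : Continuous (ouExpr φ) := by
  have h : ouExpr φ = fun x => ∑ i, (x i • partialDeriv i φ x
      - partialDeriv i (partialDeriv i φ) x) := funext (ouExpr_eq_sum hφ)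
  rw [h]
  refine continuous_finsetSum _ fun i _ => ?_
  have h1 := continuous_partialDeriv (hφ.of_le (by norm_num)) i
  have h2 := continuous_partialDeriv (contDiff_partialDeriv hφ i) i
  fun_prop

theorem hasCompactSupport_ouExpr (hφ : ContDiff ℝ 2 φ) (hc : HasCompactSupport φ) :
    HasCompactSupport (ouExpr φ) := by
  refine HasCompactSupport.intro hc fun x hx => ?_
  rw [ouExpr_eq_sum hφ]
  refine Finset.sum_eq_zero fun i _ => ?_
  have h1 : tsupport (partialDeriv i φ) ⊆ tsupport φ := tsupport_fderiv_apply_subset ℝ _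
  have h2 : tsupport (partialDeriv i (partialDeriv i φ)) ⊆ tsupport (partialDeriv i φ) :=
    tsupport_fderiv_apply_subset ℝ _
  rw [image_eq_zero_of_notMem_tsupport fun h => hx (h1 h),
    image_eq_zero_of_notMem_tsupport fun h => hx (h1 (h2 h))]
  simp

theorem partialDeriv_star (i : Fin d) (x : EuclideanSpace ℝ (Fin d)) :
    partialDeriv i (fun y => star (φ y)) x = star (partialDeriv i φ x) := by
  unfold partialDeriv
  rw [fderiv_star]
  simp

theorem partialDeriv_mul (hφ : ContDiff ℝ 1 φ) (hψ : ContDiff ℝ 1 ψ) (i : Fin d)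
    (x : EuclideanSpace ℝ (Fin d)) :
    partialDeriv i (fun y => φ y * ψ y) x
      = partialDeriv i φ x * ψ x + φ x * partialDeriv i ψ x := by
  unfold partialDeriv
  rw [fderiv_fun_mul (hφ.differentiable (by norm_num) x) (hψ.differentiable (by norm_num) x)]
  simp
  ring

theorem integral_partialDeriv (hφ : ContDiff ℝ 1 φ) (hc : HasCompactSupport φ) (i : Fin d) :
    ∫ x, partialDeriv i φ x ∂gaussMeasure d 1 = ∫ x, x i • φ x ∂gaussMeasure d 1 := by
  have h := integral_gaussMeasure_fderiv hφ hc (EuclideanSpace.single i 1)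
  simpa [partialDeriv, EuclideanSpace.inner_single_right] using h

theorem contDiff_star_comp {n : WithTop ℕ∞} (hφ : ContDiff ℝ n φ) :
    ContDiff ℝ n fun x => star (φ x) :=
  Complex.conjCLE.contDiff.comp hφ

/-- `L` is the operator of the Dirichlet form. -/
theorem integral_star_mul_ouExpr (hφ : ContDiff ℝ 1 φ) (hφc : HasCompactSupport φ)
    (hψ : ContDiff ℝ 2 ψ) :
    ∫ x, star (φ x) * ouExpr ψ x ∂gaussMeasure d 1
      = ∑ i, ∫ x, star (partialDeriv i φ x) * partialDeriv i ψ x ∂gaussMeasure d 1 := by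
  have hs := contDiff_star_comp hφ
  have hsc : HasCompactSupport fun x => star (φ x) := hφc.comp_left (star_zero ℂ)
  have hψ1 : ContDiff ℝ 1 ψ := hψ.of_le (by norm_num)
  have key : ∀ i, ∫ x, star (φ x) * (x i • partialDeriv i ψ x
      - partialDeriv i (partialDeriv i ψ) x) ∂gaussMeasure d 1
      = ∫ x, star (partialDeriv i φ x) * partialDeriv i ψ x ∂gaussMeasure d 1 := by
    intro i
    have hp := contDiff_partialDeriv hψ i
    -- Integration by parts is applied to the conjugate of `φ` times `∂ᵢψ`. The product rule
    -- produces the Dirichlet integrand and a second-order term, which is then moved to the other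
    -- side to complete `L`.
    have h := integral_partialDeriv (hs.mul hp) hsc.mul_right i
    have c1 := continuous_partialDeriv hφ i
    have c2 := continuous_partialDeriv hψ1 i
    have c3 := continuous_partialDeriv hp i
    have c0 := hφ.continuous
    have i1 : Integrable (fun x => star (partialDeriv i φ x) * partialDeriv i ψ x)
        (gaussMeasure d 1) :=
      integrable_gaussMeasure_of_continuous (hasCompactSupport_partialDeriv hφc i)
        (c1.star.mul c2) fun x hx => by simp [hx]
    have i2 : Integrable (fun x => star (φ x) * partialDeriv i (partialDeriv i ψ) x)
        (gaussMeasure d 1) :=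
      integrable_gaussMeasure_of_continuous hφc (c0.star.mul c3) fun x hx => by simp [hx]
    have i3 : Integrable (fun x => x i • (star (φ x) * partialDeriv i ψ x))
        (gaussMeasure d 1) :=
      integrable_gaussMeasure_of_continuous hφc (by fun_prop) fun x hx => by simp [hx]
    simp only [partialDeriv_mul hs hp, partialDeriv_star] at h
    rw [integral_add i1 i2] at h
    rw [← eq_sub_iff_add_eq, ← integral_sub i3 i2] at h
    rw [h]
    congr 1 with x
    rw [mul_sub, mul_smul_comm]
  simp only [ouExpr_eq_sum hψ, Finset.mul_sum]
  rw [integral_finsetSum]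
  · exact Finset.sum_congr rfl fun i _ => key i
  · intro i _
    have c2 := continuous_partialDeriv hψ1 i
    have c3 := continuous_partialDeriv (contDiff_partialDeriv hψ i) i
    have c0 := hφ.continuous
    exact integrable_gaussMeasure_of_continuous hφc (by fun_prop) fun x hx => by simp [hx]

theorem integral_star_mul_ouExpr_symm (hφ : ContDiff ℝ 2 φ) (hφc : HasCompactSupport φ)
    (hψ : ContDiff ℝ 2 ψ) (hψc : HasCompactSupport ψ) :
    ∫ x, star (φ x) * ouExpr ψ x ∂gaussMeasure d 1
      = ∫ x, star (ouExpr φ x) * ψ x ∂gaussMeasure d 1 := by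
  have h : ∫ x, star (ouExpr φ x) * ψ x ∂gaussMeasure d 1
      = star (∫ x, star (ψ x) * ouExpr φ x ∂gaussMeasure d 1) := by
    rw [Complex.star_def, ← integral_conj]
    simp [mul_comm]
  rw [h, integral_star_mul_ouExpr (hφ.of_le (by norm_num)) hφc hψ,
    integral_star_mul_ouExpr (hψ.of_le (by norm_num)) hψc hφ, star_sum]
  refine Finset.sum_congr rfl fun i _ => ?_
  rw [Complex.star_def, ← integral_conj]
  simp [mul_comm]

theorem re_integral_star_mul_ouExpr (hφ : ContDiff ℝ 2 φ) (hφc : HasCompactSupport φ) :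
    (∫ x, star (φ x) * ouExpr φ x ∂gaussMeasure d 1).re
      = ∑ i, ∫ x, ‖partialDeriv i φ x‖ ^ 2 ∂gaussMeasure d 1 := by
  rw [integral_star_mul_ouExpr (hφ.of_le (by norm_num)) hφc hφ, Complex.re_sum]
  refine Finset.sum_congr rfl fun i _ => ?_
  have h : ∀ x, star (partialDeriv i φ x) * partialDeriv i φ x
      = ((‖partialDeriv i φ x‖ ^ 2 : ℝ) : ℂ) := by
    intro x
    rw [Complex.star_def, Complex.conj_mul']
    push_cast
    rfl
  simp only [h]
  rw [integral_complex_ofReal, Complex.ofReal_re]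

/-- Integrating by parts in `∂ᵢ(xᵢ |φ|²)` gives `∫ xᵢ²|φ|² = ∫ |φ|² + 2 ∫ xᵢ Re(φ̄ ∂ᵢφ)`. The cross
term is at most `½ xᵢ²|φ|² + 2 |∂ᵢφ|²`, and its first part is absorbed on the left, which doubles
the remaining constants. -/
theorem integral_sq_coord_mul_norm_sq_le (hφ : ContDiff ℝ 1 φ) (hφc : HasCompactSupport φ)
    (i : Fin d) :
    ∫ x, (x i) ^ 2 * ‖φ x‖ ^ 2 ∂gaussMeasure d 1
      ≤ 2 * ∫ x, ‖φ x‖ ^ 2 ∂gaussMeasure d 1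
        + 4 * ∫ x, ‖partialDeriv i φ x‖ ^ 2 ∂gaussMeasure d 1 := by
  have hcf := hφ.continuous
  have hcp := continuous_partialDeriv hφ i
  have hpc := hasCompactSupport_partialDeriv hφc i
  have hd : ∀ x, fderiv ℝ (fun x => x i * ‖φ x‖ ^ 2) x (EuclideanSpace.single i 1)
      = ‖φ x‖ ^ 2 + x i * (2 * inner ℝ (φ x) (partialDeriv i φ x)) := by
    intro x
    have h1 := (hφ.differentiable (by norm_num) x).hasFDerivAt.norm_sq
    have h2 := (EuclideanSpace.proj (𝕜 := ℝ) i).hasFDerivAt (x := x)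
    have h3 := (h2.mul h1).fderiv
    change fderiv ℝ (fun x => x i * ‖φ x‖ ^ 2) x = _ at h3
    rw [h3]
    simp [partialDeriv]
    ring
  have h := integral_gaussMeasure_fderiv (h := fun x => x i * ‖φ x‖ ^ 2)
    ((EuclideanSpace.proj (𝕜 := ℝ) i).contDiff.mul (hφ.norm_sq ℝ))
    (hφc.mono fun x hx h0 => hx (by simp [h0])) (EuclideanSpace.single i 1)
  simp only [hd] at h
  have i0 : Integrable (fun x => ‖φ x‖ ^ 2) (gaussMeasure d 1) :=
    integrable_gaussMeasure_of_continuous hφc (by fun_prop) fun x hx => by simp [hx]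
  have i1 : Integrable (fun x => ‖partialDeriv i φ x‖ ^ 2) (gaussMeasure d 1) :=
    integrable_gaussMeasure_of_continuous hpc (by fun_prop) fun x hx => by simp [hx]
  have i2 : Integrable (fun x => (x i) ^ 2 * ‖φ x‖ ^ 2) (gaussMeasure d 1) :=
    integrable_gaussMeasure_of_continuous hφc (by fun_prop) fun x hx => by simp [hx]
  have i3 : Integrable (fun x => ‖φ x‖ ^ 2 + x i * (2 * inner ℝ (φ x) (partialDeriv i φ x)))
      (gaussMeasure d 1) :=
    integrable_gaussMeasure_of_continuous hφc (by fun_prop) fun x hx => by simp [hx]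
  have h4 : ∫ x, (x i) ^ 2 * ‖φ x‖ ^ 2 ∂gaussMeasure d 1 ≤ ∫ x, (‖φ x‖ ^ 2 +
      (1 / 2) * ((x i) ^ 2 * ‖φ x‖ ^ 2) + 2 * ‖partialDeriv i φ x‖ ^ 2) ∂gaussMeasure d 1 := by
    calc _ = ∫ x, (‖φ x‖ ^ 2 + x i * (2 * inner ℝ (φ x) (partialDeriv i φ x)))
          ∂gaussMeasure d 1 := by
          rw [h]
          congr 1 with x
          simp [EuclideanSpace.inner_single_right]
          ring
      _ ≤ _ := by
          refine integral_mono i3 ((i0.add (i2.const_mul _)).add (i1.const_mul _)) fun x => ?_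
          have h5 := abs_real_inner_le_norm (φ x) (partialDeriv i φ x)
          have h6 : x i * inner ℝ (φ x) (partialDeriv i φ x)
              ≤ |x i| * (‖φ x‖ * ‖partialDeriv i φ x‖) := by
            refine (le_abs_self _).trans ?_
            rw [abs_mul]
            gcongr
          have h7 := two_mul_le_add_sq (|x i| * ‖φ x‖) (2 * ‖partialDeriv i φ x‖)
          rw [mul_pow, sq_abs] at h7
          nlinarith
  have i5 : Integrable (fun x => ‖φ x‖ ^ 2 + (1 / 2) * ((x i) ^ 2 * ‖φ x‖ ^ 2))
      (gaussMeasure d 1) := i0.add (i2.const_mul _)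
  rw [integral_add i5 (i1.const_mul _), integral_add i0 (i2.const_mul _),
    integral_const_mul, integral_const_mul] at h4
  linarith

end PartialDeriv

/-! ### Plane waves -/

/-- The plane wave `x ↦ exp (i ⟪x, η⟫)`. -/
noncomputable def planeWave {d : ℕ} (η x : EuclideanSpace ℝ (Fin d)) : ℂ :=
  Complex.exp (((inner ℝ x η : ℝ) : ℂ) * Complex.I)

theorem norm_planeWave {d : ℕ} (η x : EuclideanSpace ℝ (Fin d)) : ‖planeWave η x‖ = 1 :=
  Complex.norm_exp_ofReal_mul_I _

theorem hasFDerivAt_planeWave {d : ℕ} (η x : EuclideanSpace ℝ (Fin d)) :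
    HasFDerivAt (planeWave η)
      (planeWave η x • (Complex.I • Complex.ofRealCLM ∘L innerSL ℝ η)) x := by
  have h : HasFDerivAt (fun x : EuclideanSpace ℝ (Fin d) =>
      Complex.I * ((inner ℝ η x : ℝ) : ℂ)) (Complex.I • Complex.ofRealCLM ∘L innerSL ℝ η) x :=
    ((Complex.ofRealCLM ∘L innerSL ℝ η).hasFDerivAt (x := x)).const_mul Complex.I
  have h2 := h.cexp
  have e : ∀ y, Complex.exp (Complex.I * ((inner ℝ η y : ℝ) : ℂ)) = planeWave η y := by
    intro y
    rw [planeWave, real_inner_comm, mul_comm]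
  simpa only [e] using h2

theorem contDiff_planeWave {d : ℕ} (η : EuclideanSpace ℝ (Fin d)) {n : WithTop ℕ∞} :
    ContDiff ℝ n (planeWave η) := by
  have h1 : ContDiff ℝ n fun x : EuclideanSpace ℝ (Fin d) => ((inner ℝ x η : ℝ) : ℂ) :=
    Complex.ofRealCLM.contDiff.comp (contDiff_id.inner ℝ contDiff_const)
  exact (h1.mul contDiff_const).cexp

theorem partialDeriv_planeWave {d : ℕ} (η : EuclideanSpace ℝ (Fin d)) (i : Fin d) :
    partialDeriv i (planeWave η) = fun x => (Complex.I * η i) * planeWave η x := by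
  funext x
  rw [partialDeriv, (hasFDerivAt_planeWave η x).fderiv]
  simp [EuclideanSpace.inner_single_right]
  ring

theorem ouExpr_planeWave {d : ℕ} (η x : EuclideanSpace ℝ (Fin d)) :
    ouExpr (planeWave η) x
      = ((‖η‖ ^ 2 : ℝ) + (inner ℝ x η : ℝ) * Complex.I) * planeWave η x := by
  rw [ouExpr_eq_sum (contDiff_planeWave η)]
  have h : ∀ i, partialDeriv i (partialDeriv i (planeWave η)) x
      = (Complex.I * η i) * ((Complex.I * η i) * planeWave η x) := by
    intro i
    rw [partialDeriv_planeWave]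
    change partialDeriv i (fun x => (fun _ => Complex.I * (η i : ℂ)) x * planeWave η x) x = _
    rw [partialDeriv_mul contDiff_const (contDiff_planeWave η), partialDeriv_planeWave]
    simp [partialDeriv]
  have h2 : (inner ℝ x η : ℝ) = ∑ i, x i * η i := by
    simp [PiLp.inner_apply, mul_comm]
  rw [EuclideanSpace.real_norm_sq_eq, h2]
  push_cast
  rw [Finset.sum_mul, ← Finset.sum_add_distrib, Finset.sum_mul]
  refine Finset.sum_congr rfl fun i _ => ?_
  rw [h, partialDeriv_planeWave, Complex.real_smul]
  linear_combination (-(η i : ℂ) ^ 2 * planeWave η x) * Complex.I_mul_I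

theorem iteratedDeriv_cexp_mul_I (n : ℕ) :
    iteratedDeriv n (fun t : ℝ => Complex.exp (t * Complex.I))
      = fun t : ℝ => Complex.I ^ n * Complex.exp (t * Complex.I) := by
  induction n with
  | zero => simp
  | succ n ih =>
    rw [iteratedDeriv_succ, ih]
    funext t
    have h : HasDerivAt (fun t : ℝ => (t : ℂ) * Complex.I) Complex.I t := by
      simpa using (Complex.ofRealCLM.hasDerivAt (x := t)).mul_const Complex.I
    rw [(h.cexp.const_mul (Complex.I ^ n)).deriv]
    ring

theorem norm_iteratedFDeriv_planeWave_le {d : ℕ} (η x : EuclideanSpace ℝ (Fin d)) (n : ℕ) :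
    ‖iteratedFDeriv ℝ n (planeWave η) x‖ ≤ ‖η‖ ^ n := by
  have h : planeWave η = (fun t : ℝ => Complex.exp (t * Complex.I)) ∘ innerSL ℝ η := by
    funext y
    simp [planeWave, real_inner_comm]
  have hc : ContDiff ℝ n (fun t : ℝ => Complex.exp (t * Complex.I)) :=
    (Complex.ofRealCLM.contDiff.mul contDiff_const).cexp
  rw [h, ContinuousLinearMap.iteratedFDeriv_comp_right _ hc _ le_rfl]
  refine (ContinuousMultilinearMap.norm_compContinuousLinearMap_le _ _).trans ?_
  rw [norm_iteratedFDeriv_eq_norm_iteratedDeriv, iteratedDeriv_cexp_mul_I]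
  simp [Complex.norm_exp]

/-! ### Cut-offs -/

/-- Bounded derivatives up to order two make `L φ` grow at most linearly, so all the cut-off plane
waves share one quadratic majorant. -/
theorem norm_ouExpr_le {d : ℕ} (φ : EuclideanSpace ℝ (Fin d) → ℂ)
    (x : EuclideanSpace ℝ (Fin d)) :
    ‖ouExpr φ x‖ ≤ d * ‖iteratedFDeriv ℝ 2 φ x‖ + ‖iteratedFDeriv ℝ 1 φ x‖ * ‖x‖ := by
  unfold ouExpr
  refine (norm_add_le _ _).trans (add_le_add ?_ ?_)
  · rw [norm_neg, laplacian_eq_iteratedFDeriv_orthonormalBasis φ (EuclideanSpace.basisFun _ ℝ)]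
    refine (norm_sum_le _ _).trans ?_
    refine (Finset.sum_le_card_nsmul _ _ ‖iteratedFDeriv ℝ 2 φ x‖ fun i _ => ?_).trans ?_
    · refine (ContinuousMultilinearMap.le_opNorm _ _).trans ?_
      simp [Fin.prod_univ_two]
    · simp
  · rw [norm_iteratedFDeriv_one]
    exact ContinuousLinearMap.le_opNorm _ _

theorem exists_cutoff (d : ℕ) : ∃ (χ : ℕ → EuclideanSpace ℝ (Fin d) → ℝ) (M : ℝ),
    (∀ n, ContDiff ℝ 2 (χ n)) ∧ (∀ n, HasCompactSupport (χ n)) ∧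
    (∀ x, ∀ᶠ n in Filter.atTop, χ n =ᶠ[nhds x] 1) ∧
    ∀ n, ∀ k ≤ 2, ∀ x, ‖iteratedFDeriv ℝ k (χ n) x‖ ≤ M := by
  let b : ContDiffBump (0 : EuclideanSpace ℝ (Fin d)) := ⟨1, 2, one_pos, one_lt_two⟩
  have hb : ContDiff ℝ 2 b := b.contDiff (n := 2)
  have hbk : ∀ k : ℕ, ∃ M, k ≤ 2 → ∀ x, ‖iteratedFDeriv ℝ k b x‖ ≤ M := by
    intro k
    by_cases hk : k ≤ 2
    · obtain ⟨M, hM⟩ := (b.hasCompactSupport.iteratedFDeriv (𝕜 := ℝ) k).exists_bound_of_continuous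
        (hb.continuous_iteratedFDeriv (by exact_mod_cast hk))
      exact ⟨M, fun _ => hM⟩
    · exact ⟨0, fun h => absurd h hk⟩
  choose M hM using hbk
  -- The cut-offs are the dilations `b (x / (n + 1))` of one bump. The dilation maps are
  -- contractions, so derivative bounds for `b` serve for every `n`.
  let c : ℕ → ℝ := fun n => ((n : ℝ) + 1)⁻¹
  have hc0 : ∀ n, 0 < c n := fun n => by positivity
  have hc1 : ∀ n, c n ≤ 1 := fun n => inv_le_one_of_one_le₀ (by simp)
  let g : ℕ → EuclideanSpace ℝ (Fin d) →L[ℝ] EuclideanSpace ℝ (Fin d) :=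
    fun n => c n • ContinuousLinearMap.id ℝ _
  have hg : ∀ n, ‖g n‖ ≤ 1 := by
    intro n
    refine ContinuousLinearMap.opNorm_le_bound _ zero_le_one fun x => ?_
    simp only [g, smul_apply, ContinuousLinearMap.id_apply, norm_smul,
      Real.norm_of_nonneg (hc0 n).le]
    gcongr
    exact hc1 n
  refine ⟨fun n => b ∘ g n, max (M 0) (max (M 1) (M 2)), fun n => hb.comp (g n).contDiff,
    fun n => ?_, fun x => ?_, fun n k hk x => ?_⟩
  · have : g n = ⇑(Homeomorph.smulOfNeZero (c n) (hc0 n).ne' :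
        EuclideanSpace ℝ (Fin d) ≃ₜ EuclideanSpace ℝ (Fin d)) := rfl
    change HasCompactSupport (b ∘ ⇑(g n))
    rw [this]
    exact b.hasCompactSupport.comp_homeomorph _
  · have ht : Filter.Tendsto (fun n => c n * (‖x‖ + 1)) Filter.atTop (nhds (0 * (‖x‖ + 1))) := by
      simpa [c] using (tendsto_one_div_add_atTop_nhds_zero_nat (𝕜 := ℝ)).mul_const (‖x‖ + 1)
    rw [zero_mul] at ht
    filter_upwards [ht.eventually_lt_const one_pos] with n hn
    filter_upwards [Metric.ball_mem_nhds x one_pos] with y hy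
    refine b.one_of_mem_closedBall ?_
    rw [mem_closedBall_zero_iff]
    have hy2 : ‖y‖ ≤ ‖x‖ + 1 := by
      have := norm_le_norm_add_norm_sub' y x
      rw [Metric.mem_ball, dist_eq_norm] at hy
      linarith
    calc ‖g n y‖ = c n * ‖y‖ := by simp [g, norm_smul, abs_of_pos (hc0 n)]
      _ ≤ c n * (‖x‖ + 1) := by gcongr
      _ ≤ 1 := hn.le
  · rw [ContinuousLinearMap.iteratedFDeriv_comp_right _ hb _ (by exact_mod_cast hk)]
    refine (ContinuousMultilinearMap.norm_compContinuousLinearMap_le _ _).trans ?_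
    have h1 : ∏ _i : Fin k, ‖g n‖ ≤ 1 := Finset.prod_le_one (fun _ _ => norm_nonneg _)
      fun _ _ => hg n
    refine (mul_le_of_le_one_right (norm_nonneg _) h1).trans ((hM k hk _).trans ?_)
    interval_cases k <;> simp

theorem exists_approx_planeWave {d : ℕ} (η : EuclideanSpace ℝ (Fin d)) :
    ∃ (φ : ℕ → EuclideanSpace ℝ (Fin d) → ℂ) (C : ℝ),
      (∀ n, ContDiff ℝ 2 (φ n)) ∧ (∀ n, HasCompactSupport (φ n)) ∧
      (∀ x, ∀ᶠ n in Filter.atTop, φ n x = planeWave η x) ∧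
      (∀ x, ∀ᶠ n in Filter.atTop, ouExpr (φ n) x = ouExpr (planeWave η) x) ∧
      (∀ n x, ‖φ n x‖ ≤ C * (1 + ‖x‖ ^ 2)) ∧ ∀ n x, ‖ouExpr (φ n) x‖ ≤ C * (1 + ‖x‖ ^ 2) := by
  obtain ⟨χ, M, h1, h2, h3, h4⟩ := exists_cutoff d
  have hM : 0 ≤ M := (norm_nonneg _).trans (h4 0 0 (by norm_num) 0)
  set N : ℝ := max 1 (max ‖η‖ (‖η‖ ^ 2)) with hN
  have hN0 : 0 ≤ N := zero_le_one.trans (le_max_left _ _)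
  have hpw : ∀ k ≤ 2, ∀ x, ‖iteratedFDeriv ℝ k (planeWave η) x‖ ≤ N := by
    intro k hk x
    refine (norm_iteratedFDeriv_planeWave_le η x k).trans ?_
    interval_cases k <;> simp [hN]
  -- Leibniz' rule for order `k ≤ 2`: the binomial coefficients sum to `2 ^ k ≤ 4`.
  have hbound : ∀ n, ∀ k ≤ 2, ∀ x,
      ‖iteratedFDeriv ℝ k (fun y => χ n y • planeWave η y) x‖ ≤ 4 * (M * N) := by
    intro n k hk x
    refine (norm_iteratedFDeriv_smul_le (h1 n) (contDiff_planeWave η (n := 2)) x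
      (by exact_mod_cast hk)).trans ?_
    have : ∀ i ∈ Finset.range (k + 1), (k.choose i : ℝ) * ‖iteratedFDeriv ℝ i (χ n) x‖
        * ‖iteratedFDeriv ℝ (k - i) (planeWave η) x‖ ≤ (k.choose i : ℝ) * (M * N) := by
      intro i hi
      rw [mul_assoc]
      gcongr
      · exact h4 n i (by grind) x
      · exact hpw _ (by omega) x
    refine (Finset.sum_le_sum this).trans ?_
    rw [← Finset.sum_mul, ← Nat.cast_sum, Nat.sum_range_choose]
    gcongr
    have : 2 ^ k ≤ 2 ^ 2 := Nat.pow_le_pow_right (by norm_num) hk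
    exact_mod_cast this
  refine ⟨fun n y => χ n y • planeWave η y, (d + 1) * (4 * (M * N)),
    fun n => (h1 n).smul (contDiff_planeWave η), fun n => (h2 n).smul_right, fun x => ?_,
    fun x => ?_, fun n x => ?_, fun n x => ?_⟩
  · filter_upwards [h3 x] with n hn
    simp [hn.eq_of_nhds]
  · filter_upwards [h3 x] with n hn
    have hn' : (fun y => χ n y • planeWave η y) =ᶠ[nhds x] planeWave η := by
      filter_upwards [hn] with y hy
      simp [hy]
    rw [ouExpr, ouExpr, hn'.fderiv_eq, (laplacian_congr_nhds hn').eq_of_nhds]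
  · have h := hbound n 0 (by norm_num) x
    rw [norm_iteratedFDeriv_zero] at h
    refine h.trans ?_
    have h0 : 0 ≤ 4 * (M * N) := by positivity
    nlinarith [mul_nonneg h0 (sq_nonneg ‖x‖), mul_nonneg (mul_nonneg d.cast_nonneg h0)
      (sq_nonneg ‖x‖), mul_nonneg (Nat.cast_nonneg (α := ℝ) d) h0]
  · refine (norm_ouExpr_le _ x).trans ?_
    have e2 := hbound n 2 le_rfl x
    have e1 := hbound n 1 (by norm_num) x
    have h0 : 0 ≤ 4 * (M * N) := by positivity
    calc _ ≤ d * (4 * (M * N)) + (4 * (M * N)) * (1 + ‖x‖ ^ 2) := by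
          gcongr
          nlinarith [sq_nonneg (‖x‖ - 1)]
      _ ≤ _ := by
          nlinarith [mul_nonneg (mul_nonneg (Nat.cast_nonneg (α := ℝ) d) h0) (sq_nonneg ‖x‖)]

/-! ### Totality of the plane waves -/

theorem integrable_mul_planeWave {d : ℕ} {μ : Measure (EuclideanSpace ℝ (Fin d))}
    {f : EuclideanSpace ℝ (Fin d) → ℂ} (hf : Integrable f μ) (η : EuclideanSpace ℝ (Fin d)) :
    Integrable (fun x => f x * planeWave η x) μ :=
  hf.mul_bdd (c := 1) (contDiff_planeWave η (n := 0)).continuous.aestronglyMeasurable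
    (Filter.Eventually.of_forall fun x => (norm_planeWave η x).le)

/-- The positive and negative parts of `h` are densities of finite measures. The hypothesis says
that these have the same characteristic function, hence they coincide. `ENNReal.ofReal` performs the
truncation to the positive part. -/
theorem ae_eq_zero_of_integral_ofReal_mul_planeWave {d : ℕ}
    {μ : Measure (EuclideanSpace ℝ (Fin d))} {h : EuclideanSpace ℝ (Fin d) → ℝ}
    (hh : Integrable h μ) (h0 : ∀ η, ∫ x, (h x : ℂ) * planeWave η x ∂μ = 0) :
    h =ᵐ[μ] 0 := by
  have key : ∀ k : EuclideanSpace ℝ (Fin d) → ℝ, Integrable k μ → ∀ η,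
      charFun (μ.withDensity fun x => ENNReal.ofReal (k x)) η
        = ∫ x, ((max (k x) 0 : ℝ) : ℂ) * planeWave η x ∂μ := by
    intro k hk η
    rw [charFun_apply, integral_withDensity_eq_integral_toReal_smul₀
      hk.aemeasurable.ennreal_ofReal (by simp)]
    simp [planeWave, ENNReal.toReal_ofReal']
  have i1 := isFiniteMeasure_withDensity_ofReal hh.2
  have i2 := isFiniteMeasure_withDensity_ofReal hh.neg.2
  have he : μ.withDensity (fun x => ENNReal.ofReal (h x))
      = μ.withDensity fun x => ENNReal.ofReal ((-h) x) := by
    refine Measure.ext_of_charFun (funext fun η => ?_)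
    have j1 : Integrable (fun x => ((max (h x) 0 : ℝ) : ℂ)) μ := hh.pos_part.ofReal
    have j2 : Integrable (fun x => ((max ((-h) x) 0 : ℝ) : ℂ)) μ := hh.neg.pos_part.ofReal
    rw [key h hh, key (-h) hh.neg, ← sub_eq_zero, ← integral_sub
      (integrable_mul_planeWave j1 η) (integrable_mul_planeWave j2 η), ← h0 η]
    congr 1 with x
    rw [← sub_mul, ← Complex.ofReal_sub]
    congr 2
    rcases le_total (h x) 0 with hx | hx <;> simp [hx]
  rw [withDensity_eq_iff hh.aemeasurable.ennreal_ofReal hh.neg.aemeasurable.ennreal_ofReal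
    (by simpa using (measure_lt_top (μ.withDensity fun x => ENNReal.ofReal (h x)) Set.univ).ne)]
    at he
  filter_upwards [he] with x hx
  rcases le_total (h x) 0 with hx0 | hx0
  · rw [ENNReal.ofReal_of_nonpos hx0] at hx
    have := ENNReal.ofReal_eq_zero.1 hx.symm
    simp only [Pi.neg_apply, Pi.zero_apply] at this ⊢
    linarith
  · rw [ENNReal.ofReal_of_nonpos (p := (-h) x) (by simpa using hx0)] at hx
    exact le_antisymm (ENNReal.ofReal_eq_zero.1 hx) hx0

theorem ae_eq_zero_of_integral_mul_planeWave {d : ℕ}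
    {μ : Measure (EuclideanSpace ℝ (Fin d))} {f : EuclideanSpace ℝ (Fin d) → ℂ}
    (hf : Integrable f μ) (h0 : ∀ η, ∫ x, f x * planeWave η x ∂μ = 0) :
    f =ᵐ[μ] 0 := by
  have hfc : Integrable (fun x => star (f x)) μ :=
    (Complex.conjCLE : ℂ →L[ℝ] ℂ).integrable_comp hf
  have h1 : ∀ η, ∫ x, star (f x) * planeWave η x ∂μ = 0 := by
    intro η
    -- The conjugate of the plane wave at `-η` is the plane wave at `η`, so the transform of `f̄`
    -- vanishes as well; real and imaginary parts can then be treated separately.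
    have h := congrArg star (h0 (-η))
    rw [Complex.star_def, ← integral_conj, map_zero] at h
    rw [← h]
    congr 1 with x
    rw [map_mul, Complex.star_def]
    congr 1
    simp [planeWave, ← Complex.exp_conj]
  have hre : (fun x => (f x).re) =ᵐ[μ] 0 := by
    refine ae_eq_zero_of_integral_ofReal_mul_planeWave hf.re fun η => ?_
    have h : ∀ x, (((f x).re : ℝ) : ℂ) * planeWave η x
        = (1 / 2) * (f x * planeWave η x + star (f x) * planeWave η x) := by
      intro x
      rw [Complex.re_eq_add_conj, Complex.star_def]
      ring
    simp only [h]
    rw [integral_const_mul, integral_add (integrable_mul_planeWave hf η)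
      (integrable_mul_planeWave hfc η), h0, h1]
    simp
  have him : (fun x => (f x).im) =ᵐ[μ] 0 := by
    refine ae_eq_zero_of_integral_ofReal_mul_planeWave hf.im fun η => ?_
    have h : ∀ x, (((f x).im : ℝ) : ℂ) * planeWave η x
        = (1 / (2 * Complex.I)) * (f x * planeWave η x - star (f x) * planeWave η x) := by
      intro x
      rw [Complex.im_eq_sub_conj, Complex.star_def]
      field_simp
    simp only [h]
    rw [integral_const_mul, integral_sub (integrable_mul_planeWave hf η)
      (integrable_mul_planeWave hfc η), h0, h1]
    simp
  filter_upwards [hre, him] with x h2 h3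
  exact Complex.ext h2 h3

theorem integrable_mul_quadratic {d : ℕ} {g : EuclideanSpace ℝ (Fin d) → ℂ}
    (hg : MemLp g 2 (gaussMeasure d 1)) (C : ℝ) :
    Integrable (fun x => ‖g x‖ * (C * (1 + ‖x‖ ^ 2))) (gaussMeasure d 1) := by
  have h : MemLp (fun x : EuclideanSpace ℝ (Fin d) => C * (1 + ‖x‖ ^ 2)) 2
      (gaussMeasure d 1) := by
    refine memLp_two_of_norm_le (C := |C|) (by fun_prop) fun x => ?_
    rw [norm_mul, Real.norm_eq_abs, Real.norm_of_nonneg (by positivity)]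
  exact hg.norm.integrable_mul h

/-- Plane waves are not compactly supported; cut-offs and dominated convergence with majorant `|g|
(1 + |x|²)` reach them. The pair `(a, b)` is `(1, 0)` for density of `C_c²` and `(1, 1)` for density
of its image under `I + L`. -/
theorem integral_mul_planeWave_eq_zero_of_forall {d : ℕ} {g : EuclideanSpace ℝ (Fin d) → ℂ}
    (hg : MemLp g 2 (gaussMeasure d 1)) (a b : ℂ)
    (h : ∀ φ : EuclideanSpace ℝ (Fin d) → ℂ, ContDiff ℝ 2 φ → HasCompactSupport φ →
      ∫ x, g x * (a * φ x + b * ouExpr φ x) ∂gaussMeasure d 1 = 0)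
    (η : EuclideanSpace ℝ (Fin d)) :
    ∫ x, g x * (a * planeWave η x + b * ouExpr (planeWave η) x) ∂gaussMeasure d 1 = 0 := by
  obtain ⟨φ, C, h1, h2, h3, h4, h5, h6⟩ := exists_approx_planeWave η
  have ht := tendsto_integral_of_dominated_convergence (μ := gaussMeasure d 1)
    (F := fun n x => g x * (a * φ n x + b * ouExpr (φ n) x))
    (f := fun x => g x * (a * planeWave η x + b * ouExpr (planeWave η) x))
    (fun x => ‖g x‖ * (((‖a‖ + ‖b‖) * C) * (1 + ‖x‖ ^ 2)))
    (fun n => hg.1.mul (((h1 n).continuous.const_smul a).add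
      ((continuous_ouExpr (h1 n)).const_smul b)).aestronglyMeasurable)
    (integrable_mul_quadratic hg _)
    (fun n => Filter.Eventually.of_forall fun x => ?_)
    (Filter.Eventually.of_forall fun x => ?_)
  · simp only [h _ (h1 _) (h2 _)] at ht
    exact (tendsto_const_nhds_iff.1 ht).symm
  · rw [norm_mul]
    gcongr
    refine (norm_add_le _ _).trans ?_
    rw [norm_mul, norm_mul]
    have e5 := mul_le_mul_of_nonneg_left (h5 n x) (norm_nonneg a)
    have e6 := mul_le_mul_of_nonneg_left (h6 n x) (norm_nonneg b)
    linarith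
  · refine tendsto_const_nhds.congr' ?_
    filter_upwards [h3 x, h4 x] with n hn hn'
    simp [hn, hn']

/-- Compactly supported `C²` functions are total in `L²(γ)`. -/
theorem ae_eq_zero_of_forall_integral_mul {d : ℕ} {g : EuclideanSpace ℝ (Fin d) → ℂ}
    (hg : MemLp g 2 (gaussMeasure d 1))
    (h : ∀ φ : EuclideanSpace ℝ (Fin d) → ℂ, ContDiff ℝ 2 φ → HasCompactSupport φ →
      ∫ x, g x * φ x ∂gaussMeasure d 1 = 0) : g =ᵐ[gaussMeasure d 1] 0 := by
  refine ae_eq_zero_of_integral_mul_planeWave (hg.integrable one_le_two) fun η => ?_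
  simpa using integral_mul_planeWave_eq_zero_of_forall hg 1 0 (by simpa using h) η

/-- The image of `C_c²` under `I + L` is total in `L²(γ)`. -/
theorem ae_eq_zero_of_forall_integral_mul_add_ouExpr {d : ℕ}
    {g : EuclideanSpace ℝ (Fin d) → ℂ} (hg : MemLp g 2 (gaussMeasure d 1))
    (h : ∀ φ : EuclideanSpace ℝ (Fin d) → ℂ, ContDiff ℝ 2 φ → HasCompactSupport φ →
      ∫ x, g x * (φ x + ouExpr φ x) ∂gaussMeasure d 1 = 0) : g =ᵐ[gaussMeasure d 1] 0 := by
  have hgi := hg.integrable one_le_two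
  refine ae_eq_zero_of_integral_mul_planeWave hgi fun η => ?_
  have hw : ∀ s : ℝ, ∫ x, g x * (planeWave (s • η) x + ouExpr (planeWave (s • η)) x)
      ∂gaussMeasure d 1 = 0 := fun s => by
    simpa using integral_mul_planeWave_eq_zero_of_forall hg 1 1 (by simpa using h) (s • η)
  -- `G` is the Fourier transform of `g γ` along the ray through `η`, and `G'` its derivative. On a
  -- plane wave `L` multiplies by `|η|² + i ⟪x, η⟫`, and the second term is a differentiation in
  -- `s`.
  let G : ℝ → ℂ := fun s => ∫ x, g x * planeWave (s • η) x ∂gaussMeasure d 1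
  let G' : ℝ → ℂ := fun s =>
    ∫ x, g x * ((inner ℝ x η : ℝ) * Complex.I * planeWave (s • η) x) ∂gaussMeasure d 1
  have hbd : Integrable (fun x => ‖g x‖ * (‖η‖ * (1 + ‖x‖ ^ 2))) (gaussMeasure d 1) :=
    integrable_mul_quadratic hg _
  have hcpw : ∀ η : EuclideanSpace ℝ (Fin d), Continuous (planeWave η) :=
    fun η => (contDiff_planeWave η (n := 0)).continuous
  have hle : ∀ (s : ℝ) (x : EuclideanSpace ℝ (Fin d)),
      ‖g x * ((inner ℝ x η : ℝ) * Complex.I * planeWave (s • η) x)‖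
        ≤ ‖g x‖ * (‖η‖ * (1 + ‖x‖ ^ 2)) := by
    intro s x
    rw [norm_mul, norm_mul, norm_planeWave, norm_mul, Complex.norm_I, Complex.norm_real]
    have h1 : ‖x‖ ≤ 1 + ‖x‖ ^ 2 := by nlinarith [sq_nonneg (‖x‖ - 1)]
    have h2 := norm_inner_le_norm (𝕜 := ℝ) x η
    rw [mul_one, mul_one]
    gcongr
    calc _ ≤ ‖x‖ * ‖η‖ := h2
      _ = ‖η‖ * ‖x‖ := mul_comm _ _
      _ ≤ _ := by gcongr
  have hmeas : ∀ s : ℝ, AEStronglyMeasurable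
      (fun x => g x * ((inner ℝ x η : ℝ) * Complex.I * planeWave (s • η) x))
      (gaussMeasure d 1) := by
    intro s
    have := hcpw (s • η)
    exact hg.1.mul (by fun_prop)
  have hder : ∀ s, HasDerivAt G (G' s) s := by
    intro s
    refine (hasDerivAt_integral_of_dominated_loc_of_deriv_le (s := Set.univ)
      (F := fun (s : ℝ) x => g x * planeWave (s • η) x)
      (F' := fun (s : ℝ) x => g x * ((inner ℝ x η : ℝ) * Complex.I * planeWave (s • η) x)) Filter.univ_mem
      (Filter.Eventually.of_forall fun s => (integrable_mul_planeWave hgi _).1)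
      (integrable_mul_planeWave hgi _) (hmeas s)
      (Filter.Eventually.of_forall fun x s _ => hle s x) hbd
      (Filter.Eventually.of_forall fun x s _ => ?_)).2
    have h1 : HasDerivAt (fun s : ℝ => ((inner ℝ x (s • η) : ℝ) : ℂ) * Complex.I)
        ((inner ℝ x η : ℝ) * Complex.I) s := by
      simp only [inner_smul_right, Complex.ofReal_mul]
      simpa [mul_assoc] using
        (Complex.ofRealCLM.hasDerivAt (x := s)).mul_const ((inner ℝ x η : ℝ) * Complex.I)
    have h2 := h1.cexp.const_mul (g x)
    simpa only [planeWave, mul_comm] using h2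
  have hode : ∀ s, (1 + ((s ^ 2 * ‖η‖ ^ 2 : ℝ) : ℂ)) * G s + s * G' s = 0 := by
    intro s
    rw [← hw s, ← integral_const_mul, ← integral_const_mul, ← integral_add
      ((integrable_mul_planeWave hgi _).const_mul _) ((hbd.mono' (hmeas s)
        (Filter.Eventually.of_forall (hle s))).const_mul _)]
    congr 1 with x
    rw [ouExpr_planeWave, norm_smul, mul_pow, Real.norm_eq_abs, sq_abs, inner_smul_right]
    push_cast
    ring
  -- Integrating factor for the ODE `(1 + s²|η|²) G + s G' = 0`. The factor `s` makes `K 0 = 0`, so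
  -- the constant function `K` is zero and `G 1 = 0`.
  let K : ℝ → ℂ := fun s => s * Complex.exp (((s ^ 2 * ‖η‖ ^ 2 / 2 : ℝ) : ℂ)) * G s
  have hK : ∀ s, HasDerivAt K 0 s := by
    intro s
    have h1 : HasDerivAt (fun s : ℝ => (((s ^ 2 * ‖η‖ ^ 2 / 2 : ℝ) : ℂ)))
        (((s * ‖η‖ ^ 2 : ℝ) : ℂ)) s := by
      refine HasDerivAt.ofReal_comp ?_
      have h0 : HasDerivAt (fun s : ℝ => s ^ 2 * ‖η‖ ^ 2 / 2) _ s :=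
        ((hasDerivAt_pow 2 s).mul_const (‖η‖ ^ 2)).div_const 2
      refine h0.congr_deriv ?_
      simp
      ring
    have h2 : HasDerivAt K _ s :=
      (((hasDerivAt_id s).ofReal_comp).mul h1.cexp).mul (hder s)
    refine h2.congr_deriv ?_
    have := hode s
    push_cast at this ⊢
    simp only [id, Pi.mul_apply]
    linear_combination (Complex.exp ((s : ℂ) ^ 2 * (‖η‖ : ℂ) ^ 2 / 2)) * this
  have hc := is_const_of_deriv_eq_zero (fun s => (hK s).differentiableAt)
    (fun s => (hK s).deriv) 1 0
  have hG1 : G 1 = 0 := by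
    simpa [K, Complex.exp_ne_zero] using hc
  simpa [G] using hG1

/-! ### The resolvent -/

/-- A closed relation `Γ` on a Banach space with `‖u‖ ≤ ‖u + v‖` for `(u, v) ∈ Γ` and such that
the elements `u + v` are dense has a bounded everywhere defined `(I + Γ)⁻¹`. -/
theorem exists_resolvent_of_isClosed {H : Type*} [NormedAddCommGroup H] [NormedSpace ℂ H]
    [CompleteSpace H] (Γ : Submodule ℂ (H × H)) (hΓ : IsClosed (Γ : Set (H × H)))
    (hle : ∀ w ∈ Γ, ‖w.1‖ ≤ ‖w.1 + w.2‖)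
    (hd : Dense {f : H | ∃ w ∈ Γ, w.1 + w.2 = f}) :
    ∃ R : H →L[ℂ] H, (∀ f, (R f, f - R f) ∈ Γ) ∧ ∀ w ∈ Γ, R (w.1 + w.2) = w.1 := by
  have : CompleteSpace Γ := hΓ.completeSpace_coe
  let T : Γ →L[ℂ] H :=
    (ContinuousLinearMap.fst ℂ H H + ContinuousLinearMap.snd ℂ H H) ∘L Γ.subtypeL
  have hT : ∀ w : Γ, T w = w.1.1 + w.1.2 := fun w => rfl
  -- `T` is bounded below, so it is injective with closed range; density of the range makes it onto.
  have hb : ∀ w : Γ, ‖w‖ ≤ 2 * ‖T w‖ := by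
    intro w
    have h1 := hle w.1 w.2
    rw [← hT] at h1
    have h2 : ‖w.1.2‖ ≤ ‖T w‖ + ‖w.1.1‖ := by
      have : w.1.2 = T w - w.1.1 := by rw [hT]; abel
      rw [this]
      exact norm_sub_le _ _
    refine (Prod.norm_def w.1).trans_le (max_le ?_ ?_)
    · linarith [norm_nonneg (T w)]
    · linarith
  have ha : AntilipschitzWith 2 T := T.antilipschitz_of_bound (by exact_mod_cast hb)
  have hr : Set.range T = Set.univ := by
    rw [← (ha.isClosed_range T.uniformContinuous).closure_eq]
    refine Set.eq_univ_of_univ_subset ?_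
    rw [← hd.closure_eq]
    refine closure_mono ?_
    rintro f ⟨w, hw, rfl⟩
    exact ⟨⟨w, hw⟩, rfl⟩
  let e : Γ ≃ₗ[ℂ] H := LinearEquiv.ofBijective T.toLinearMap ⟨ha.injective, Set.range_eq_univ.1 hr⟩
  have he : ∀ f, (e.symm f).1.1 + (e.symm f).1.2 = f := fun f => e.apply_symm_apply f
  let R : H →L[ℂ] H := LinearMap.mkContinuous
    (LinearMap.fst ℂ H H ∘ₗ Γ.subtype ∘ₗ e.symm.toLinearMap) 1 (fun f => by
      have := hle _ (e.symm f).2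
      rw [he] at this
      simpa using this)
  have hR : ∀ f, R f = (e.symm f).1.1 := fun f => rfl
  refine ⟨R, fun f => ?_, fun w hw => ?_⟩
  · have h1 : (R f, f - R f) = (e.symm f).1 := by
      refine Prod.ext rfl ?_
      rw [sub_eq_iff_eq_add', hR, he]
    rw [h1]
    exact (e.symm f).2
  · rw [hR, show w.1 + w.2 = e ⟨w, hw⟩ from rfl, e.symm_apply_apply]

/-! ### The Ornstein-Uhlenbeck graph, its closure and its resolvent -/

section Graph

variable {d : ℕ}

theorem exists_mem_ouGraph {φ : EuclideanSpace ℝ (Fin d) → ℂ} (hφ : ContDiff ℝ 2 φ)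
    (hc : HasCompactSupport φ) :
    ∃ w ∈ ouGraph d, w.1 =ᵐ[gaussMeasure d 1] φ ∧ w.2 =ᵐ[gaussMeasure d 1] ouExpr φ := by
  have m1 : MemLp φ 2 (gaussMeasure d 1) := hφ.continuous.memLp_of_hasCompactSupport hc
  have m2 : MemLp (ouExpr φ) 2 (gaussMeasure d 1) :=
    (continuous_ouExpr hφ).memLp_of_hasCompactSupport (hasCompactSupport_ouExpr hφ hc)
  exact ⟨(m1.toLp φ, m2.toLp (ouExpr φ)), ⟨φ, hφ, hc, m1.coeFn_toLp, m2.coeFn_toLp⟩,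
    m1.coeFn_toLp, m2.coeFn_toLp⟩

theorem L2Gauss.inner_eq_integral {u v : L2Gauss d} {f g : EuclideanSpace ℝ (Fin d) → ℂ}
    (hu : u =ᵐ[gaussMeasure d 1] f) (hv : v =ᵐ[gaussMeasure d 1] g) :
    inner ℂ u v = ∫ x, star (f x) * g x ∂gaussMeasure d 1 := by
  rw [L2.inner_def]
  refine integral_congr_ae ?_
  filter_upwards [hu, hv] with x h1 h2
  rw [h1, h2, RCLike.inner_apply, mul_comm]
  rfl

theorem ouGraph_symm {w w' : L2Gauss d × L2Gauss d} (hw : w ∈ ouGraph d) (hw' : w' ∈ ouGraph d) :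
    inner ℂ w.1 w'.2 = inner ℂ w.2 w'.1 := by
  obtain ⟨φ, h1, h2, h3, h4⟩ := hw
  obtain ⟨ψ, k1, k2, k3, k4⟩ := hw'
  rw [L2Gauss.inner_eq_integral h3 k4, L2Gauss.inner_eq_integral h4 k3,
    integral_star_mul_ouExpr_symm h1 h2 k1 k2]

theorem closure_ouGraph_symm {w w' : L2Gauss d × L2Gauss d}
    (hw : w ∈ (ouGraph d).topologicalClosure) (hw' : w' ∈ (ouGraph d).topologicalClosure) :
    inner ℂ w.1 w'.2 = inner ℂ w.2 w'.1 := by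
  have hcl : ∀ w' ∈ ouGraph d, ∀ w ∈ (ouGraph d).topologicalClosure,
      inner ℂ w.1 w'.2 = inner ℂ w.2 w'.1 := by
    intro w' hw' w hw
    have hc : IsClosed {w : L2Gauss d × L2Gauss d | inner ℂ w.1 w'.2 = inner ℂ w.2 w'.1} :=
      isClosed_eq (continuous_fst.inner continuous_const) (continuous_snd.inner continuous_const)
    exact closure_minimal (fun w hw => ouGraph_symm hw hw') hc hw
  have hc : IsClosed {w' : L2Gauss d × L2Gauss d | inner ℂ w.1 w'.2 = inner ℂ w.2 w'.1} :=
    isClosed_eq (continuous_const.inner continuous_snd) (continuous_const.inner continuous_fst)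
  exact closure_minimal (fun w' hw' => hcl w' hw' w hw) hc hw'

/-- Pair `(I + L) φ` with `φ`: the real part of `⟪φ, L φ⟫` is the Dirichlet form, and Cauchy-Schwarz
bounds the pairing from above. -/
theorem ouGraph_norm_sq_add_form_le {φ : EuclideanSpace ℝ (Fin d) → ℂ} (h1 : ContDiff ℝ 2 φ)
    (h2 : HasCompactSupport φ) {w : L2Gauss d × L2Gauss d} (h3 : w.1 =ᵐ[gaussMeasure d 1] φ)
    (h4 : w.2 =ᵐ[gaussMeasure d 1] ouExpr φ) :
    ‖w.1‖ ^ 2 + ∑ i, ∫ x, ‖partialDeriv i φ x‖ ^ 2 ∂gaussMeasure d 1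
      ≤ ‖w.1‖ * ‖w.1 + w.2‖ := by
  have h5 : (inner ℂ w.1 w.2 : ℂ).re
      = ∑ i, ∫ x, ‖partialDeriv i φ x‖ ^ 2 ∂gaussMeasure d 1 := by
    rw [L2Gauss.inner_eq_integral h3 h4, re_integral_star_mul_ouExpr h1 h2]
  have h6 : (inner ℂ w.1 (w.1 + w.2) : ℂ).re = ‖w.1‖ ^ 2 + (inner ℂ w.1 w.2 : ℂ).re := by
    rw [inner_add_right, Complex.add_re]
    congr 1
    exact inner_self_eq_norm_sq (𝕜 := ℂ) w.1
  rw [← h5, ← h6]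
  exact (Complex.re_le_norm _).trans (norm_inner_le_norm _ _)

theorem closure_ouGraph_norm_le {w : L2Gauss d × L2Gauss d}
    (hw : w ∈ (ouGraph d).topologicalClosure) : ‖w.1‖ ≤ ‖w.1 + w.2‖ := by
  have hc : IsClosed {w : L2Gauss d × L2Gauss d | ‖w.1‖ ≤ ‖w.1 + w.2‖} :=
    isClosed_le continuous_fst.norm (continuous_fst.add continuous_snd).norm
  refine closure_minimal (fun w hw => ?_) hc hw
  obtain ⟨φ, h1, h2, h3, h4⟩ := hw
  have h := ouGraph_norm_sq_add_form_le h1 h2 h3 h4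
  have h0 : 0 ≤ ∑ i, ∫ x, ‖partialDeriv i φ x‖ ^ 2 ∂gaussMeasure d 1 :=
    Finset.sum_nonneg fun i _ => integral_nonneg fun x => by positivity
  rcases (norm_nonneg w.1).eq_or_lt with h5 | h5
  · exact h5.symm.trans_le (norm_nonneg (w.1 + w.2))
  · exact le_of_mul_le_mul_left (by nlinarith) h5

theorem memLp_star (u : L2Gauss d) :
    MemLp (fun x => star ((u : EuclideanSpace ℝ (Fin d) → ℂ) x)) 2 (gaussMeasure d 1) :=
  (Lp.memLp u).star

theorem L2Gauss.eq_zero_of_ae_star_eq_zero {u : L2Gauss d}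
    (h : (fun x => star ((u : EuclideanSpace ℝ (Fin d) → ℂ) x)) =ᵐ[gaussMeasure d 1] 0) :
    u = 0 := by
  rw [Lp.eq_zero_iff_ae_eq_zero]
  filter_upwards [h] with x hx
  simpa using hx

/-- If `(0, v)` lies in the closure of the graph, symmetry gives `⟪v, φ⟫ = ⟪0, L φ⟫ = 0` for all `φ`
in `C_c²`, a dense set. -/
theorem ouCore_isClosable (d : ℕ) : (ouCore d).IsClosable := by
  refine ⟨(ouGraph d).topologicalClosure.toLinearPMap, ?_⟩
  rw [ouCore_graph, Submodule.toLinearPMap_graph_eq]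
  intro w hw h0
  refine L2Gauss.eq_zero_of_ae_star_eq_zero
    (ae_eq_zero_of_forall_integral_mul (memLp_star w.2) fun φ h1 h2 => ?_)
  obtain ⟨w', h3, h4, -⟩ := exists_mem_ouGraph h1 h2
  rw [← L2Gauss.inner_eq_integral (Filter.EventuallyEq.refl _ _) h4,
    ← closure_ouGraph_symm hw ((ouGraph d).le_topologicalClosure h3), h0, inner_zero_left]

theorem ornsteinUhlenbeck_graph (d : ℕ) :
    (ornsteinUhlenbeck d).graph = (ouGraph d).topologicalClosure := by
  rw [ornsteinUhlenbeck, ← (ouCore_isClosable d).graph_closure_eq_closure_graph, ouCore_graph]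

theorem dense_range_one_add_ouGraph (d : ℕ) :
    Dense {f : L2Gauss d | ∃ w ∈ (ouGraph d).topologicalClosure, w.1 + w.2 = f} := by
  let K : Submodule ℂ (L2Gauss d) :=
    (ouGraph d).map (LinearMap.fst ℂ (L2Gauss d) (L2Gauss d) + LinearMap.snd ℂ _ _)
  have hK : K.topologicalClosure = ⊤ := by
    rw [Submodule.topologicalClosure_eq_top_iff, Submodule.eq_bot_iff]
    intro u hu
    refine L2Gauss.eq_zero_of_ae_star_eq_zero
      (ae_eq_zero_of_forall_integral_mul_add_ouExpr (memLp_star u) fun φ h1 h2 => ?_)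
    obtain ⟨w, h3, h4, h5⟩ := exists_mem_ouGraph h1 h2
    have h6 := Submodule.inner_left_of_mem_orthogonal (𝕜 := ℂ) (Submodule.mem_map_of_mem h3) hu
    rw [← h6]
    exact (L2Gauss.inner_eq_integral (Filter.EventuallyEq.refl _ _)
      ((Lp.coeFn_add w.1 w.2).trans (h4.add h5))).symm
  have hd : Dense (K : Set (L2Gauss d)) := (Submodule.dense_iff_topologicalClosure_eq_top).2 hK
  refine hd.mono ?_
  rintro f ⟨w, hw, rfl⟩
  exact ⟨w, (ouGraph d).le_topologicalClosure hw, rfl⟩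

theorem exists_resolvent_ornsteinUhlenbeck (d : ℕ) :
    ∃ R : L2Gauss d →L[ℂ] L2Gauss d, IsResolventOneAdd (ornsteinUhlenbeck d) R ∧
      ∀ f, (R f, f - R f) ∈ (ouGraph d).topologicalClosure := by
  obtain ⟨R, h1, h2⟩ := exists_resolvent_of_isClosed (ouGraph d).topologicalClosure
    (ouGraph d).isClosed_topologicalClosure (fun w hw => closure_ouGraph_norm_le hw)
    (dense_range_one_add_ouGraph d)
  refine ⟨R, ⟨fun f => ?_, fun u => ?_⟩, h1⟩
  · have h := h1 f
    rw [← ornsteinUhlenbeck_graph, LinearPMap.mem_graph_iff] at h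
    obtain ⟨y, hy1, hy2⟩ := h
    simp only at hy1 hy2
    refine ⟨hy1 ▸ y.2, ?_⟩
    have : (⟨R f, hy1 ▸ y.2⟩ : (ornsteinUhlenbeck d).domain) = y := Subtype.ext hy1.symm
    rw [this, hy2]
    abel
  · refine h2 ((u : L2Gauss d), ornsteinUhlenbeck d u) ?_
    rw [← ornsteinUhlenbeck_graph]
    exact LinearPMap.mem_graph _ u

end Graph

/-! ### The Sobolev embedding -/

section Sobolev

variable {d : ℕ}

/-- The pointwise size `‖v‖ + ‖∇v‖` that defines the `H¹` norm. -/
noncomputable def sobolevDensity (v : EuclideanSpace ℝ (Fin d) → ℂ)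
    (x : EuclideanSpace ℝ (Fin d)) : ℝ :=
  ‖v x‖ + ‖fderiv ℝ v x‖

theorem sobolevDensity_nonneg (v : EuclideanSpace ℝ (Fin d) → ℂ) (x : EuclideanSpace ℝ (Fin d)) :
    0 ≤ sobolevDensity v x := by
  unfold sobolevDensity; positivity

theorem continuous_sobolevDensity {v : EuclideanSpace ℝ (Fin d) → ℂ} (hv : ContDiff ℝ 1 v) :
    Continuous (sobolevDensity v) :=
  hv.continuous.norm.add (hv.continuous_fderiv (by norm_num)).norm

theorem eLpNorm_two_eq_lintegral {α F : Type*} [MeasurableSpace α] [NormedAddCommGroup F]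
    (μ : Measure α) (f : α → F) : eLpNorm f 2 μ = (∫⁻ x, ‖f x‖ₑ ^ 2 ∂μ) ^ (1 / 2 : ℝ) := by
  rw [eLpNorm_eq_lintegral_rpow_enorm_toReal (by norm_num) (by norm_num)]
  simp

/-- A local Sobolev inequality in dimension at least two. -/
theorem exists_local_sobolev (hd : 2 ≤ d) {q : ℝ≥0} (hq : 2 ≤ q)
    (hqd : 1 / 2 < (q : ℝ)⁻¹ + (d : ℝ)⁻¹) (r : ℝ) :
    ∃ C : ℝ≥0, ∀ u : EuclideanSpace ℝ (Fin d) → ℂ, ContDiff ℝ 1 u →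
      Function.support u ⊆ Metric.closedBall 0 r →
      eLpNorm u q volume ≤ C * eLpNorm (fderiv ℝ u) 2
        (volume.restrict (Metric.closedBall (0 : EuclideanSpace ℝ (Fin d)) r)) := by
  have hd' : (2 : ℝ) ≤ d := by exact_mod_cast hd
  have hq' : (2 : ℝ) ≤ q := by exact_mod_cast hq
  have hdi : (d : ℝ)⁻¹ ≤ 2⁻¹ := inv_anti₀ two_pos hd'
  have hqi : (q : ℝ)⁻¹ ≤ 2⁻¹ := inv_anti₀ two_pos hq'
  have hd0 : 0 < (d : ℝ)⁻¹ := by positivity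
  have hq0 : 0 < (q : ℝ)⁻¹ := by positivity
  -- This exponent has `q` as its Sobolev conjugate: `1/p - 1/d = 1/q`. The bound `p ≥ 1` needs `d ≥
  -- 2`, and `p ≤ 2` is the subcriticality of `q`, which lets Hölder on the ball pass from `L^p` to
  -- `L²`.
  let p : ℝ≥0 := (q⁻¹ + (d : ℝ≥0)⁻¹)⁻¹
  have hpR : (p : ℝ) = ((q : ℝ)⁻¹ + (d : ℝ)⁻¹)⁻¹ := by simp [p]
  have hp1 : 1 ≤ p := by
    rw [← NNReal.coe_le_coe, hpR, NNReal.coe_one]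
    exact (one_le_inv₀ (by positivity)).2 (by linarith)
  have hp2 : p ≤ 2 := by
    rw [← NNReal.coe_le_coe, hpR]
    refine (inv_le_comm₀ (by positivity) (by positivity)).2 ?_
    norm_num at hqd ⊢
    linarith
  have hpd : p < (Module.finrank ℝ (EuclideanSpace ℝ (Fin d)) : ℝ≥0) := by
    rw [finrank_euclideanSpace_fin, ← NNReal.coe_lt_coe, hpR, NNReal.coe_natCast]
    refine (inv_lt_comm₀ (by positivity) (by positivity)).2 ?_
    linarith
  have hpq : ((p⁻¹ : ℝ≥0) : ℝ) - (Module.finrank ℝ (EuclideanSpace ℝ (Fin d)) : ℝ)⁻¹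
      ≤ (q : ℝ)⁻¹ := by
    rw [finrank_euclideanSpace_fin, NNReal.coe_inv, hpR, inv_inv]
    linarith
  set B := Metric.closedBall (0 : EuclideanSpace ℝ (Fin d)) r with hB
  have hBfin : (volume.restrict B) Set.univ ≠ ∞ := by
    rw [Measure.restrict_apply_univ]
    exact (isCompact_closedBall _ _).measure_lt_top.ne
  obtain ⟨K, hK⟩ : ∃ K : ℝ≥0, (K : ℝ≥0∞) = (volume.restrict B) Set.univ
      ^ (1 / (p : ℝ≥0∞).toReal - 1 / (2 : ℝ≥0∞).toReal) := by
    refine ⟨_, ENNReal.coe_toNNReal (ENNReal.rpow_ne_top_of_nonneg ?_ hBfin)⟩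
    have : (p : ℝ) ≤ 2 := hp2
    simp only [ENNReal.coe_toReal, ENNReal.toReal_ofNat, sub_nonneg]
    exact one_div_le_one_div_of_le (by positivity) this
  refine ⟨eLpNormLESNormFDerivOfLeConst ℂ (volume : Measure (EuclideanSpace ℝ (Fin d))) B p q * K,
    fun u hu hs => ?_⟩
  refine (eLpNorm_le_eLpNorm_fderiv_of_le volume hu hs hp1 hpd hpq
    Metric.isBounded_closedBall).trans ?_
  have hsupp : Function.support (fderiv ℝ u) ⊆ B :=
    (subset_tsupport _).trans ((tsupport_fderiv_subset ℝ).trans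
      (closure_minimal hs Metric.isClosed_closedBall))
  rw [ENNReal.coe_mul, mul_assoc]
  gcongr
  have hres := eLpNorm_restrict_eq_of_support_subset (μ := volume) (p := (p : ℝ≥0∞))
    (f := fderiv ℝ u) hsupp
  rw [← hres, hK, mul_comm]
  exact eLpNorm_le_eLpNorm_mul_rpow_measure_univ (by exact_mod_cast hp2)
    (hu.continuous_fderiv (by norm_num)).aestronglyMeasurable

theorem exists_norm_fderiv_smul_translate_le {χ : EuclideanSpace ℝ (Fin d) → ℝ}
    (hχ : ContDiff ℝ 1 χ) (hc : HasCompactSupport χ) :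
    ∃ M : ℝ≥0, ∀ v : EuclideanSpace ℝ (Fin d) → ℂ, ContDiff ℝ 1 v → ∀ a x,
      ‖fderiv ℝ (fun y => χ y • v (a + y)) x‖ ≤ M * sobolevDensity v (a + x) := by
  obtain ⟨M1, hM1⟩ := hc.exists_bound_of_continuous hχ.continuous
  obtain ⟨M2, hM2⟩ := (hc.fderiv ℝ).exists_bound_of_continuous
    (hχ.continuous_fderiv (by norm_num))
  have h1 : 0 ≤ M1 := (norm_nonneg _).trans (hM1 0)
  have h2 : 0 ≤ M2 := (norm_nonneg _).trans (hM2 0)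
  refine ⟨⟨M1 + M2, by positivity⟩, fun v hv a x => ?_⟩
  have hvd : DifferentiableAt ℝ (fun y => v (a + y)) x :=
    (hv.differentiable (by norm_num)).differentiableAt.comp x (by fun_prop)
  rw [fderiv_fun_smul (hχ.differentiable (by norm_num) x) hvd, fderiv_comp_add_left]
  refine (norm_add_le _ _).trans ?_
  rw [norm_smul]
  have e1 : ‖χ x‖ * ‖fderiv ℝ v (a + x)‖ ≤ M1 * ‖fderiv ℝ v (a + x)‖ := by gcongr; exact hM1 x
  have e2 : ‖(fderiv ℝ χ x).smulRight (v (a + x))‖ ≤ M2 * ‖v (a + x)‖ := by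
    rw [ContinuousLinearMap.norm_smulRight_apply]
    gcongr
    exact hM2 x
  refine (add_le_add e1 e2).trans ?_
  change _ ≤ (M1 + M2) * (‖v (a + x)‖ + ‖fderiv ℝ v (a + x)‖)
  nlinarith [mul_nonneg h1 (norm_nonneg (v (a + x))),
    mul_nonneg h2 (norm_nonneg (fderiv ℝ v (a + x)))]

/-- The subcritical Sobolev embedding `H¹ ⊆ L^q` in dimension at least two. -/
theorem exists_sobolev_of_two_le (hd : 2 ≤ d) {q : ℝ≥0} (hq : 2 ≤ q)
    (hqd : 1 / 2 < (q : ℝ)⁻¹ + (d : ℝ)⁻¹) :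
    ∃ C : ℝ≥0, ∀ v : EuclideanSpace ℝ (Fin d) → ℂ, ContDiff ℝ 1 v → HasCompactSupport v →
      eLpNorm v q volume ≤ C * eLpNorm (sobolevDensity v) 2 volume := by
  let χ : ContDiffBump (0 : EuclideanSpace ℝ (Fin d)) := ⟨1, 2, one_pos, one_lt_two⟩
  have hχ : ContDiff ℝ 1 χ := χ.contDiff (n := 1)
  obtain ⟨C, hC⟩ := exists_local_sobolev hd hq hqd 2
  obtain ⟨M, hM⟩ := exists_norm_fderiv_smul_translate_le hχ χ.hasCompactSupport
  set B := Metric.closedBall (0 : EuclideanSpace ℝ (Fin d)) 2 with hB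
  have hq' : (2 : ℝ) ≤ q := by exact_mod_cast hq
  have hq0 : (0 : ℝ) < q := by linarith
  have hqne : (q : ℝ≥0∞) ≠ 0 := by
    have : q ≠ 0 := by rintro rfl; simp at hq0
    exact_mod_cast this
  set k : ℝ≥0∞ := ∫⁻ x, ‖χ x‖ₑ ^ (q : ℝ) with hk
  have hk0 : k ≠ 0 := by
    refine ((Metric.measure_closedBall_pos volume (0 : EuclideanSpace ℝ (Fin d))
      one_pos).trans_le ?_).ne'
    calc _ = ∫⁻ x in Metric.closedBall (0 : EuclideanSpace ℝ (Fin d)) 1, 1 := by simp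
      _ ≤ ∫⁻ x in Metric.closedBall (0 : EuclideanSpace ℝ (Fin d)) 1, ‖χ x‖ₑ ^ (q : ℝ) := by
          refine setLIntegral_mono' Metric.isClosed_closedBall.measurableSet fun x hx => ?_
          rw [χ.one_of_mem_closedBall hx]
          simp
      _ ≤ k := setLIntegral_le_lintegral _ _
  have hktop : k ≠ ∞ := by
    have h := (hχ.continuous.memLp_of_hasCompactSupport (p := q) (μ := volume)
      χ.hasCompactSupport)
    have := lintegral_rpow_enorm_lt_top_of_eLpNorm_lt_top hqne ENNReal.coe_ne_top h.2
    simpa using this.ne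
  have hBfin : volume B ≠ ∞ := (isCompact_closedBall _ _).measure_lt_top.ne
  -- The local inequality is applied to `χ · v(a + ·)`, raised to the power `q` and integrated over
  -- all `a`. The left side becomes `k ‖v‖_q^q`. On the right `F a ^ (q/2) ≤ F a * W ^ (q/2 - 1)`,
  -- since `q ≥ 2` and `F ≤ W`, and `∫ F = vol(B) W`. Hence `‖v‖_q^q ≤ A W ^ (q/2)`.
  let A : ℝ≥0∞ := k⁻¹ * (((C * M : ℝ≥0) : ℝ≥0∞) ^ (q : ℝ) * volume B)
  have hA : A ^ (1 / (q : ℝ)) ≠ ∞ := by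
    refine ENNReal.rpow_ne_top_of_nonneg (by positivity) (ENNReal.mul_ne_top
      (ENNReal.inv_ne_top.2 hk0) (ENNReal.mul_ne_top
        (ENNReal.rpow_ne_top_of_nonneg (by positivity) ENNReal.coe_ne_top) hBfin))
  refine ⟨(A ^ (1 / (q : ℝ))).toNNReal, fun v hv hvc => ?_⟩
  rw [ENNReal.coe_toNNReal hA]
  have hwc := continuous_sobolevDensity hv
  let F : EuclideanSpace ℝ (Fin d) → ℝ≥0∞ :=
    fun a => ∫⁻ x in B, ‖sobolevDensity v (a + x)‖ₑ ^ 2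
  let W : ℝ≥0∞ := ∫⁻ x, ‖sobolevDensity v x‖ₑ ^ 2
  have hFW : ∀ a, F a ≤ W := by
    intro a
    refine (setLIntegral_le_lintegral _ _).trans ?_
    exact (lintegral_add_left_eq_self (fun x => ‖sobolevDensity v x‖ₑ ^ 2) a).le
  have hlocal : ∀ a, ∫⁻ x, ‖χ x‖ₑ ^ (q : ℝ) * ‖v (a + x)‖ₑ ^ (q : ℝ)
      ≤ ((C * M : ℝ≥0) : ℝ≥0∞) ^ (q : ℝ) * F a ^ ((q : ℝ) / 2) := by
    intro a
    have hu : ContDiff ℝ 1 fun y => χ y • v (a + y) :=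
      hχ.smul (hv.comp (contDiff_const.add contDiff_id))
    have h1 := hC _ hu (fun x hx => by
      have hx' : x ∈ Function.support χ := fun h => hx (by simp [h])
      rw [χ.support_eq] at hx'
      exact Metric.ball_subset_closedBall hx')
    have h2 : eLpNorm (fderiv ℝ fun y => χ y • v (a + y)) 2 (volume.restrict B)
        ≤ M * F a ^ (1 / 2 : ℝ) := by
      have h3 := eLpNorm_le_nnreal_smul_eLpNorm_of_ae_le_mul
        (f := fderiv ℝ fun y => χ y • v (a + y)) (g := fun x => sobolevDensity v (a + x))
        (c := M) (μ := volume.restrict B) (Filter.Eventually.of_forall fun x => by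
          have := hM v hv a x
          rw [← NNReal.coe_le_coe]
          simpa [abs_of_nonneg (sobolevDensity_nonneg v (a + x))] using this) 2
      refine h3.trans_eq ?_
      rw [eLpNorm_two_eq_lintegral]
      rfl
    have h4 : eLpNorm (fun y => χ y • v (a + y)) q volume
        ≤ ((C * M : ℝ≥0) : ℝ≥0∞) * F a ^ (1 / 2 : ℝ) := by
      rw [ENNReal.coe_mul, mul_assoc]
      exact h1.trans (by gcongr)
    have h5 := ENNReal.rpow_le_rpow h4 hq0.le
    rw [eLpNorm_eq_lintegral_rpow_enorm_toReal hqne ENNReal.coe_ne_top, ← ENNReal.rpow_mul,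
      ENNReal.coe_toReal, one_div_mul_cancel hq0.ne', ENNReal.rpow_one,
      ENNReal.mul_rpow_of_nonneg _ _ hq0.le, ← ENNReal.rpow_mul] at h5
    calc _ = ∫⁻ x, ‖χ x • v (a + x)‖ₑ ^ (q : ℝ) := by
          congr 1 with x
          rw [enorm_smul, ENNReal.mul_rpow_of_nonneg _ _ hq0.le]
      _ ≤ _ := h5
      _ = _ := by
        congr 2
        ring
  have hleft : ∫⁻ a, ∫⁻ x, ‖χ x‖ₑ ^ (q : ℝ) * ‖v (a + x)‖ₑ ^ (q : ℝ)
      = k * ∫⁻ x, ‖v x‖ₑ ^ (q : ℝ) := by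
    rw [lintegral_lintegral_swap]
    · have : ∀ x, ∫⁻ a, ‖χ x‖ₑ ^ (q : ℝ) * ‖v (a + x)‖ₑ ^ (q : ℝ)
          = ‖χ x‖ₑ ^ (q : ℝ) * ∫⁻ a, ‖v a‖ₑ ^ (q : ℝ) := by
        intro x
        rw [lintegral_const_mul' _ _ (ENNReal.rpow_ne_top_of_nonneg hq0.le enorm_ne_top),
          lintegral_add_right_eq_self (fun a => ‖v a‖ₑ ^ (q : ℝ)) x]
      simp only [this]
      rw [lintegral_mul_const _ (hχ.continuous.enorm.measurable.pow_const _)]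
    · have h1 := hχ.continuous
      have h2 := hv.continuous
      have h3 : Measurable fun z : EuclideanSpace ℝ (Fin d) × EuclideanSpace ℝ (Fin d) =>
          ‖χ z.2‖ₑ ^ (q : ℝ) * ‖v (z.1 + z.2)‖ₑ ^ (q : ℝ) :=
        ((h1.comp continuous_snd).enorm.measurable.pow_const _).mul
          ((h2.comp (continuous_fst.add continuous_snd)).enorm.measurable.pow_const _)
      exact h3.aemeasurable
  have hFint : ∫⁻ a, F a = volume B * W := by
    rw [lintegral_lintegral_swap]
    · simp only [lintegral_add_right_eq_self (fun a => ‖sobolevDensity v a‖ₑ ^ 2)]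
      rw [lintegral_const, Measure.restrict_apply_univ, mul_comm]
    · have h3 : Measurable fun z : EuclideanSpace ℝ (Fin d) × EuclideanSpace ℝ (Fin d) =>
          ‖sobolevDensity v (z.1 + z.2)‖ₑ ^ 2 :=
        (hwc.comp (continuous_fst.add continuous_snd)).enorm.measurable.pow_const _
      exact h3.aemeasurable
  have hFpow : ∀ a, F a ^ ((q : ℝ) / 2) ≤ F a * W ^ ((q : ℝ) / 2 - 1) := by
    intro a
    have h0 : (q : ℝ) / 2 = 1 + ((q : ℝ) / 2 - 1) := by ring
    have h1 : 0 ≤ (q : ℝ) / 2 - 1 := by linarith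
    nth_rewrite 1 [h0]
    rw [ENNReal.rpow_add_of_nonneg _ _ zero_le_one h1, ENNReal.rpow_one]
    gcongr
    exact hFW a
  have hmain : k * ∫⁻ x, ‖v x‖ₑ ^ (q : ℝ)
      ≤ ((C * M : ℝ≥0) : ℝ≥0∞) ^ (q : ℝ) * volume B * W ^ ((q : ℝ) / 2) := by
    have hFm : Measurable F := by
      refine Measurable.lintegral_prod_right' (f := fun z : EuclideanSpace ℝ (Fin d) ×
        EuclideanSpace ℝ (Fin d) => ‖sobolevDensity v (z.1 + z.2)‖ₑ ^ 2) ?_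
      exact (hwc.comp (continuous_fst.add continuous_snd)).enorm.measurable.pow_const _
    rw [← hleft]
    calc _ ≤ ∫⁻ a, ((C * M : ℝ≥0) : ℝ≥0∞) ^ (q : ℝ) * (F a * W ^ ((q : ℝ) / 2 - 1)) :=
          lintegral_mono fun a => (hlocal a).trans (by gcongr; exact hFpow a)
      _ = ((C * M : ℝ≥0) : ℝ≥0∞) ^ (q : ℝ) * (volume B * W * W ^ ((q : ℝ) / 2 - 1)) := by
          rw [lintegral_const_mul _ (hFm.mul_const _), lintegral_mul_const _ hFm, hFint]
      _ = _ := by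
          have h0 : (q : ℝ) / 2 = 1 + ((q : ℝ) / 2 - 1) := by ring
          have h1 : 0 ≤ (q : ℝ) / 2 - 1 := by linarith
          have h2 : W ^ ((q : ℝ) / 2) = W * W ^ ((q : ℝ) / 2 - 1) := by
            conv_lhs => rw [h0, ENNReal.rpow_add_of_nonneg _ _ zero_le_one h1, ENNReal.rpow_one]
          rw [h2]
          ring
  rw [eLpNorm_eq_lintegral_rpow_enorm_toReal hqne ENNReal.coe_ne_top, eLpNorm_two_eq_lintegral,
    ENNReal.coe_toReal]
  have h6 : ∫⁻ x, ‖v x‖ₑ ^ (q : ℝ) ≤ A * W ^ ((q : ℝ) / 2) := by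
    have := ENNReal.mul_le_iff_le_inv hk0 hktop |>.1 hmain
    refine this.trans_eq ?_
    simp only [A]
    ring
  calc _ ≤ (A * W ^ ((q : ℝ) / 2)) ^ (1 / (q : ℝ)) := ENNReal.rpow_le_rpow h6 (by positivity)
    _ = A ^ (1 / (q : ℝ)) * W ^ (1 / 2 : ℝ) := by
      rw [ENNReal.mul_rpow_of_nonneg _ _ (by positivity), ← ENNReal.rpow_mul]
      congr 2
      field_simp

end Sobolev

/-! ### The Sobolev embedding in dimension one -/

section SobolevOne

/-- By the fundamental theorem of calculus for `v²`, `|v|² ≤ ∫ 2 |v| |v'| ≤ ∫ (|v| + |v'|)²`. -/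
theorem enorm_sq_le_lintegral_sobolevDensity {v : EuclideanSpace ℝ (Fin 1) → ℂ}
    (hv : ContDiff ℝ 1 v) (hc : HasCompactSupport v) (x : EuclideanSpace ℝ (Fin 1)) :
    ‖v x‖ₑ ^ 2 ≤ ∫⁻ y, ‖sobolevDensity v y‖ₑ ^ 2 := by
  let e : ℝ ≃ₗᵢ[ℝ] EuclideanSpace ℝ (Fin 1) :=
    (LinearIsometry.toSpanSingleton ℝ _ (v := EuclideanSpace.single (0 : Fin 1) (1 : ℝ))
      (by simp)).toLinearIsometryEquiv (by simp)
  let f : ℝ → ℂ := fun t => v (e t)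
  have hf : ContDiff ℝ 1 f := hv.comp e.contDiff
  have hfc : HasCompactSupport f := hc.comp_homeomorph e.toHomeomorph
  have hd : ∀ t, HasDerivAt f (fderiv ℝ v (e t) (e 1)) t := by
    intro t
    have h1 : HasFDerivAt v (fderiv ℝ v (e t)) (e t) :=
      (hv.differentiable (by norm_num) _).hasFDerivAt
    have h2 : HasDerivAt e (e 1) t :=
      (e.toContinuousLinearEquiv : ℝ →L[ℝ] EuclideanSpace ℝ (Fin 1)).hasDerivAt
    exact h1.comp_hasDerivAt t h2
  have h1 := HasCompactSupport.enorm_le_lintegral_Ici_deriv (f := fun t => f t * f t)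
    (hf.mul hf) hfc.mul_right (e.symm x)
  have h2 : ∀ t, ‖deriv (fun t => f t * f t) t‖ₑ ≤ ‖sobolevDensity v (e t)‖ₑ ^ 2 := by
    intro t
    have h3 : deriv (fun t => f t * f t) t = _ := ((hd t).mul (hd t)).deriv
    rw [h3, ← enorm_pow, ← ofReal_norm, ← ofReal_norm]
    refine ENNReal.ofReal_le_ofReal ?_
    have h4 : ‖fderiv ℝ v (e t) (e 1)‖ ≤ ‖fderiv ℝ v (e t)‖ := by
      refine (ContinuousLinearMap.le_opNorm _ _).trans_eq ?_
      simp
    rw [norm_pow, Real.norm_of_nonneg (sobolevDensity_nonneg _ _), sobolevDensity]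
    refine (norm_add_le _ _).trans ?_
    rw [norm_mul, norm_mul]
    have h5 : ‖f t‖ * ‖fderiv ℝ v (e t) (e 1)‖ ≤ ‖v (e t)‖ * ‖fderiv ℝ v (e t)‖ :=
      mul_le_mul_of_nonneg_left h4 (norm_nonneg _)
    nlinarith [norm_nonneg (v (e t)), norm_nonneg (fderiv ℝ v (e t)),
      sq_nonneg ‖v (e t)‖, sq_nonneg ‖fderiv ℝ v (e t)‖]
  have h6 : ‖f (e.symm x) * f (e.symm x)‖ₑ = ‖v x‖ₑ ^ 2 := by
    simp [f, enorm_mul, sq]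
  rw [← h6]
  calc _ ≤ ∫⁻ t in Set.Iic (e.symm x), ‖deriv (fun t => f t * f t) t‖ₑ := h1
    _ ≤ ∫⁻ t, ‖deriv (fun t => f t * f t) t‖ₑ := setLIntegral_le_lintegral _ _
    _ ≤ ∫⁻ t, ‖sobolevDensity v (e t)‖ₑ ^ 2 := lintegral_mono h2
    _ = _ := e.measurePreserving.lintegral_comp
      ((continuous_sobolevDensity hv).enorm.measurable.pow_const _)

/-- For finite `q`, interpolate the sup bound with `L²`: `|v|^q ≤ W^(q/2 - 1) |v|²`. The case `q =
∞` is needed for `p = 1`, which the main theorem allows when `d = 1`. -/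
theorem eLpNorm_le_eLpNorm_sobolevDensity_of_dim_one {q : ℝ≥0∞} (hq : 2 ≤ q)
    {v : EuclideanSpace ℝ (Fin 1) → ℂ} (hv : ContDiff ℝ 1 v) (hc : HasCompactSupport v) :
    eLpNorm v q volume ≤ eLpNorm (sobolevDensity v) 2 volume := by
  have hsup := enorm_sq_le_lintegral_sobolevDensity hv hc
  rw [eLpNorm_two_eq_lintegral]
  set W := ∫⁻ y, ‖sobolevDensity v y‖ₑ ^ 2 with hW
  by_cases hqt : q = ∞
  · rw [hqt, eLpNorm_exponent_top]
    refine eLpNormEssSup_le_of_ae_enorm_bound (Filter.Eventually.of_forall fun x => ?_)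
    have := ENNReal.rpow_le_rpow (hsup x) (by norm_num : (0 : ℝ) ≤ 1 / 2)
    rwa [← ENNReal.rpow_natCast, ← ENNReal.rpow_mul, Nat.cast_ofNat, mul_one_div_cancel two_ne_zero,
      ENNReal.rpow_one] at this
  · have hq2 : (2 : ℝ) ≤ q.toReal := by
      simpa using ENNReal.toReal_mono hqt hq
    have hq0 : 0 < q.toReal := by linarith
    have h1 : ∀ x, ‖v x‖ₑ ^ q.toReal ≤ W ^ (q.toReal / 2 - 1) * ‖sobolevDensity v x‖ₑ ^ 2 := by
      intro x
      have h2 : ‖v x‖ₑ ≤ ‖sobolevDensity v x‖ₑ := by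
        rw [← ofReal_norm, ← ofReal_norm]
        refine ENNReal.ofReal_le_ofReal ?_
        rw [Real.norm_of_nonneg (sobolevDensity_nonneg _ _)]
        exact le_add_of_nonneg_right (norm_nonneg _)
      have h3 : ‖v x‖ₑ ^ q.toReal = (‖v x‖ₑ ^ 2) ^ (q.toReal / 2 - 1) * ‖v x‖ₑ ^ 2 := by
        rw [← ENNReal.rpow_natCast, ← ENNReal.rpow_mul, ← ENNReal.rpow_add_of_nonneg _ _
          (by push_cast; linarith) (by norm_num)]
        congr 1
        push_cast
        ring
      rw [h3]
      gcongr
      · linarith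
      · exact hsup x
    have h4 : ∫⁻ x, ‖v x‖ₑ ^ q.toReal ≤ W ^ (q.toReal / 2) := by
      refine (lintegral_mono h1).trans_eq ?_
      rw [lintegral_const_mul _ ((continuous_sobolevDensity hv).enorm.measurable.pow_const _),
        ← hW]
      conv_lhs => rw [← ENNReal.rpow_one W, ← ENNReal.rpow_mul]
      rw [one_mul, ← ENNReal.rpow_add_of_nonneg _ _ (by linarith) zero_le_one, sub_add_cancel]
    rw [eLpNorm_eq_lintegral_rpow_enorm_toReal (by positivity) hqt]
    refine (ENNReal.rpow_le_rpow h4 (by positivity)).trans_eq ?_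
    rw [← ENNReal.rpow_mul]
    congr 1
    field_simp

end SobolevOne

/-- The subcritical Sobolev embedding `H¹ ⊆ L^q`. -/
theorem exists_sobolev {d : ℕ} (hd : 1 ≤ d) {q : ℝ≥0∞} (hq : 2 ≤ q)
    (hqd : 1 / 2 < (q⁻¹).toReal + (d : ℝ)⁻¹) :
    ∃ C : ℝ≥0, ∀ v : EuclideanSpace ℝ (Fin d) → ℂ, ContDiff ℝ 1 v → HasCompactSupport v →
      eLpNorm v q volume ≤ C * eLpNorm (sobolevDensity v) 2 volume := by
  obtain rfl | hd2 := hd.eq_or_lt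
  · exact ⟨1, fun v hv hc => by
      simpa using eLpNorm_le_eLpNorm_sobolevDensity_of_dim_one hq hv hc⟩
  · have hd2' : (2 : ℝ) ≤ d := by exact_mod_cast hd2
    -- For `q = ∞` the hypothesis would read `1/2 < 1/d`, impossible for `d ≥ 2`.
    have hqt : q ≠ ∞ := by
      rintro rfl
      have := inv_anti₀ two_pos hd2'
      simp at hqd
      linarith
    lift q to ℝ≥0 using hqt
    refine exists_sobolev_of_two_le hd2 (by exact_mod_cast hq) ?_
    simpa [ENNReal.toReal_inv] using hqd

/-! ### The weighted Sobolev inequality for the Ornstein-Uhlenbeck operator -/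

section Weighted

variable {d : ℕ}

/-- The origin of the weight `2/p`: `exp(-|x|²/4) ^ p = exp(-|x|² / (2 · (2/p)))`. Taking the
exponent `2` gives that the density of `γ_1` is a multiple of the squared density of `γ_2`. -/
theorem exists_gaussDensity_eq_const_mul_rpow (d : ℕ) {p : ℝ} (hp : 0 < p) :
    ∃ K : ℝ, 0 < K ∧ ∀ x, gaussDensity d (2 / p) x = K * gaussDensity d 2 x ^ p := by
  refine ⟨(2 * Real.pi * (2 / p)) ^ (-(d : ℝ) / 2) * (((2 * Real.pi * 2) ^ (-(d : ℝ) / 2)) ^ p)⁻¹,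
    by positivity, fun x => ?_⟩
  unfold gaussDensity
  have hc : ((2 * Real.pi * 2) ^ (-(d : ℝ) / 2)) ^ p ≠ 0 := by positivity
  rw [Real.mul_rpow (by positivity) (Real.exp_pos _).le, ← Real.exp_mul,
    mul_assoc (_ ^ (-(d : ℝ) / 2)) _⁻¹, inv_mul_cancel_left₀ hc]
  congr 2
  field_simp

theorem norm_fderiv_sq_le_sum (φ : EuclideanSpace ℝ (Fin d) → ℂ) (x : EuclideanSpace ℝ (Fin d)) :
    ‖fderiv ℝ φ x‖ ^ 2 ≤ ∑ i, ‖partialDeriv i φ x‖ ^ 2 := by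
  have h0 : 0 ≤ ∑ i, ‖partialDeriv i φ x‖ ^ 2 := Finset.sum_nonneg fun i _ => by positivity
  rw [← Real.le_sqrt (norm_nonneg _) h0]
  refine ContinuousLinearMap.opNorm_le_bound _ (Real.sqrt_nonneg _) fun y => ?_
  rw [fderiv_apply_eq_sum]
  calc _ ≤ ∑ i, ‖partialDeriv i φ x‖ * ‖y i‖ := by
        refine (norm_sum_le _ _).trans (Finset.sum_le_sum fun i _ => ?_)
        rw [norm_smul, mul_comm]
    _ ≤ √(∑ i, ‖partialDeriv i φ x‖ ^ 2) * √(∑ i, ‖y i‖ ^ 2) :=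
        Real.sum_mul_le_sqrt_mul_sqrt _ _ _
    _ = _ := by rw [EuclideanSpace.norm_eq y]

theorem sobolevDensity_gaussDensity_smul_sq_le {φ : EuclideanSpace ℝ (Fin d) → ℂ}
    (hφ : ContDiff ℝ 1 φ) (x : EuclideanSpace ℝ (Fin d)) :
    sobolevDensity (fun y => gaussDensity d 2 y • φ y) x ^ 2
      ≤ gaussDensity d 2 x ^ 2 * (3 * (‖φ x‖ ^ 2 + ∑ i, ‖partialDeriv i φ x‖ ^ 2
        + ∑ i, (x i) ^ 2 * ‖φ x‖ ^ 2)) := by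
  have hg := (gaussDensity_pos d (τ := 2) two_pos x).le
  have h1 : ‖fderiv ℝ (fun y => gaussDensity d 2 y • φ y) x‖
      ≤ gaussDensity d 2 x * (‖fderiv ℝ φ x‖ + ‖x‖ * ‖φ x‖) := by
    rw [fderiv_fun_smul (hasFDerivAt_gaussDensity d x).differentiableAt
      (hφ.differentiable (by norm_num) x), (hasFDerivAt_gaussDensity d x).fderiv]
    refine (norm_add_le _ _).trans ?_
    rw [norm_smul, ContinuousLinearMap.norm_smulRight_apply, norm_smul, innerSL_apply_norm, norm_neg,
      norm_div, Real.norm_of_nonneg hg, Real.norm_ofNat, mul_add]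
    refine add_le_add le_rfl ?_
    have : 0 ≤ gaussDensity d 2 x * (‖x‖ * ‖φ x‖) := by positivity
    nlinarith
  have h2 : ‖gaussDensity d 2 x • φ x‖ = gaussDensity d 2 x * ‖φ x‖ := by
    rw [norm_smul, Real.norm_of_nonneg hg]
  have h3 : sobolevDensity (fun y => gaussDensity d 2 y • φ y) x
      ≤ gaussDensity d 2 x * (‖φ x‖ + ‖fderiv ℝ φ x‖ + ‖x‖ * ‖φ x‖) := by
    rw [sobolevDensity, h2]
    linarith
  have h4 : (‖φ x‖ + ‖fderiv ℝ φ x‖ + ‖x‖ * ‖φ x‖) ^ 2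
      ≤ 3 * (‖φ x‖ ^ 2 + ‖fderiv ℝ φ x‖ ^ 2 + (‖x‖ * ‖φ x‖) ^ 2) := by
    nlinarith [sq_nonneg (‖φ x‖ - ‖fderiv ℝ φ x‖), sq_nonneg (‖φ x‖ - ‖x‖ * ‖φ x‖),
      sq_nonneg (‖fderiv ℝ φ x‖ - ‖x‖ * ‖φ x‖)]
  have h5 : ∑ i, (x i) ^ 2 * ‖φ x‖ ^ 2 = (‖x‖ * ‖φ x‖) ^ 2 := by
    rw [← Finset.sum_mul, mul_pow, EuclideanSpace.real_norm_sq_eq]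
  rw [h5]
  calc _ ≤ (gaussDensity d 2 x * (‖φ x‖ + ‖fderiv ℝ φ x‖ + ‖x‖ * ‖φ x‖)) ^ 2 :=
        pow_le_pow_left₀ (sobolevDensity_nonneg _ _) h3 2
    _ = gaussDensity d 2 x ^ 2 * (‖φ x‖ + ‖fderiv ℝ φ x‖ + ‖x‖ * ‖φ x‖) ^ 2 := mul_pow _ _ _
    _ ≤ _ := by
        gcongr
        refine h4.trans ?_
        gcongr
        exact norm_fderiv_sq_le_sum φ x

theorem norm_sq_eq_integral {u : L2Gauss d} {φ : EuclideanSpace ℝ (Fin d) → ℂ}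
    (h : u =ᵐ[gaussMeasure d 1] φ) : ‖u‖ ^ 2 = ∫ x, ‖φ x‖ ^ 2 ∂gaussMeasure d 1 := by
  rw [← inner_self_eq_norm_sq (𝕜 := ℂ) u, L2Gauss.inner_eq_integral h h]
  have h2 : ∀ x, star (φ x) * φ x = ((‖φ x‖ ^ 2 : ℝ) : ℂ) := by
    intro x
    rw [Complex.star_def, Complex.conj_mul']
    push_cast
    rfl
  simp only [h2]
  rw [integral_complex_ofReal]
  rfl

theorem integrable_norm_sq_of_contDiff {φ : EuclideanSpace ℝ (Fin d) → ℂ} (hφ : ContDiff ℝ 1 φ)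
    (hc : HasCompactSupport φ) : Integrable (fun x => ‖φ x‖ ^ 2 + ∑ i, ‖partialDeriv i φ x‖ ^ 2
      + ∑ i, (x i) ^ 2 * ‖φ x‖ ^ 2) (gaussMeasure d 1) := by
  have hcf := hφ.continuous
  refine Integrable.add (Integrable.add ?_ (integrable_finsetSum _ fun i _ => ?_))
    (integrable_finsetSum _ fun i _ => ?_)
  · exact integrable_gaussMeasure_of_continuous hc (by fun_prop) fun x hx => by simp [hx]
  · exact integrable_gaussMeasure_of_continuous (hasCompactSupport_partialDeriv hc i)
      ((continuous_partialDeriv hφ i).norm.pow 2) fun x hx => by simp [hx]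
  · exact integrable_gaussMeasure_of_continuous hc (by fun_prop) fun x hx => by simp [hx]

theorem integral_weighted_sobolev_le {φ : EuclideanSpace ℝ (Fin d) → ℂ} (hφ : ContDiff ℝ 1 φ)
    (hc : HasCompactSupport φ) :
    ∫ x, (‖φ x‖ ^ 2 + ∑ i, ‖partialDeriv i φ x‖ ^ 2 + ∑ i, (x i) ^ 2 * ‖φ x‖ ^ 2)
      ∂gaussMeasure d 1 ≤ (5 + 2 * d) * (∫ x, ‖φ x‖ ^ 2 ∂gaussMeasure d 1
        + ∑ i, ∫ x, ‖partialDeriv i φ x‖ ^ 2 ∂gaussMeasure d 1) := by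
  have hcf := hφ.continuous
  have i0 : Integrable (fun x => ‖φ x‖ ^ 2) (gaussMeasure d 1) :=
    integrable_gaussMeasure_of_continuous hc (by fun_prop) fun x hx => by simp [hx]
  have i1 : ∀ i, Integrable (fun x => ‖partialDeriv i φ x‖ ^ 2) (gaussMeasure d 1) := fun i =>
    integrable_gaussMeasure_of_continuous (hasCompactSupport_partialDeriv hc i)
      ((continuous_partialDeriv hφ i).norm.pow 2) fun x hx => by simp [hx]
  have i2 : ∀ i : Fin d, Integrable (fun x => (x i) ^ 2 * ‖φ x‖ ^ 2) (gaussMeasure d 1) :=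
    fun i => integrable_gaussMeasure_of_continuous hc (by fun_prop) fun x hx => by simp [hx]
  have i12 : Integrable (fun x => ‖φ x‖ ^ 2 + ∑ i, ‖partialDeriv i φ x‖ ^ 2)
      (gaussMeasure d 1) := i0.add (integrable_finsetSum _ fun i _ => i1 i)
  have i3 : Integrable (fun x => ∑ i, (x i) ^ 2 * ‖φ x‖ ^ 2) (gaussMeasure d 1) :=
    integrable_finsetSum _ fun i _ => i2 i
  rw [integral_add i12 i3, integral_add i0 (integrable_finsetSum _ fun i _ => i1 i),
    integral_finsetSum _ fun i _ => i1 i, integral_finsetSum _ fun i _ => i2 i]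
  have h5 := Finset.sum_le_sum fun i (_ : i ∈ Finset.univ) =>
    integral_sq_coord_mul_norm_sq_le hφ hc i
  rw [Finset.sum_add_distrib, Finset.sum_const, Finset.card_univ, Fintype.card_fin,
    nsmul_eq_mul, ← Finset.mul_sum Finset.univ
      (fun i => ∫ x, ‖partialDeriv i φ x‖ ^ 2 ∂gaussMeasure d 1) 4] at h5
  have h6 : 0 ≤ ∑ i, ∫ x, ‖partialDeriv i φ x‖ ^ 2 ∂gaussMeasure d 1 :=
    Finset.sum_nonneg fun i _ => integral_nonneg fun x => by positivity
  have h7 : 0 ≤ ∫ x, ‖φ x‖ ^ 2 ∂gaussMeasure d 1 := integral_nonneg fun x => by positivity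
  have h8 := mul_nonneg (Nat.cast_nonneg (α := ℝ) d) h6
  -- The coefficients are `1 + 2d` for `∫ |φ|²` and `1 + 4` for the Dirichlet form; `5 + 2d`
  -- dominates both.
  linarith

theorem eLpNorm_sobolevDensity_sq {v : EuclideanSpace ℝ (Fin d) → ℂ} (hv : ContDiff ℝ 1 v)
    (hc : HasCompactSupport v) :
    Integrable (fun x => sobolevDensity v x ^ 2) ∧ eLpNorm (sobolevDensity v) 2 volume
      = ENNReal.ofReal √(∫ x, sobolevDensity v x ^ 2) := by
  have iv : Integrable (fun x => sobolevDensity v x ^ 2) := by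
    refine ((continuous_sobolevDensity hv).pow 2).integrable_of_hasCompactSupport ?_
    have : HasCompactSupport (sobolevDensity v) := hc.norm.add (hc.fderiv ℝ).norm
    exact this.mono fun x hx h0 => hx (by simp [h0])
  refine ⟨iv, ?_⟩
  rw [eLpNorm_two_eq_lintegral, Real.sqrt_eq_rpow, ← ENNReal.ofReal_rpow_of_nonneg
    (integral_nonneg fun x => by positivity) (by norm_num),
    ofReal_integral_eq_lintegral_ofReal iv (Filter.Eventually.of_forall fun x => by positivity)]
  congr 2 with x
  rw [Real.enorm_of_nonneg (sobolevDensity_nonneg _ _),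
    ENNReal.ofReal_pow (sobolevDensity_nonneg _ _)]

theorem hasCompactSupport_gaussDensity_smul {φ : EuclideanSpace ℝ (Fin d) → ℂ}
    (hc : HasCompactSupport φ) (τ : ℝ) : HasCompactSupport fun y => gaussDensity d τ y • φ y :=
  hc.mono fun x hx h0 => hx (by simp [h0])

theorem exists_eLpNorm_sobolevDensity_le (d : ℕ) :
    ∃ C : ℝ≥0, ∀ φ : EuclideanSpace ℝ (Fin d) → ℂ, ContDiff ℝ 2 φ → HasCompactSupport φ →
      ∀ w : L2Gauss d × L2Gauss d, w.1 =ᵐ[gaussMeasure d 1] φ →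
      w.2 =ᵐ[gaussMeasure d 1] ouExpr φ →
      eLpNorm (sobolevDensity fun y => gaussDensity d 2 y • φ y) 2 volume
        ≤ C * ‖w.1 + w.2‖ₑ := by
  obtain ⟨K, hK, hKx⟩ := exists_gaussDensity_eq_const_mul_rpow d two_pos
  simp only [div_self (two_ne_zero (α := ℝ)), Real.rpow_ofNat] at hKx
  -- `K⁻¹` converts `ρ² dx` into `γ_1`, `3` comes from squaring a sum of three terms, and `5 + 2d`
  -- from absorbing `|x| φ`.
  refine ⟨(√(K⁻¹ * (3 * (5 + 2 * d)))).toNNReal, fun φ h1 h2 w h3 h4 => ?_⟩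
  have hφ1 : ContDiff ℝ 1 φ := h1.of_le (by norm_num)
  have hle := closure_ouGraph_norm_le ((ouGraph d).le_topologicalClosure
    (show w ∈ ouGraph d from ⟨φ, h1, h2, h3, h4⟩))
  have hform := (ouGraph_norm_sq_add_form_le h1 h2 h3 h4).trans
    (mul_le_mul_of_nonneg_right hle (norm_nonneg _))
  rw [norm_sq_eq_integral h3, ← sq] at hform
  have hvd : ContDiff ℝ 1 fun y => gaussDensity d 2 y • φ y :=
    (contDiff_gaussDensity d 2).smul hφ1
  obtain ⟨iv, hv⟩ := eLpNorm_sobolevDensity_sq hvd (hasCompactSupport_gaussDensity_smul h2 2)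
  have hI : ∫ x, sobolevDensity (fun y => gaussDensity d 2 y • φ y) x ^ 2
      ≤ K⁻¹ * (3 * (5 + 2 * d)) * ‖w.1 + w.2‖ ^ 2 := by
    calc _ ≤ ∫ x, gaussDensity d 1 x • ((K⁻¹ * 3) * (‖φ x‖ ^ 2
          + ∑ i, ‖partialDeriv i φ x‖ ^ 2 + ∑ i, (x i) ^ 2 * ‖φ x‖ ^ 2)) := by
          refine integral_mono iv ((integrable_gaussMeasure_iff one_pos).1
            ((integrable_norm_sq_of_contDiff hφ1 h2).const_mul (K⁻¹ * 3))) fun x => ?_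
          refine (sobolevDensity_gaussDensity_smul_sq_le hφ1 x).trans_eq ?_
          simp only [hKx, smul_eq_mul]
          field_simp
      _ = (K⁻¹ * 3) * ∫ x, (‖φ x‖ ^ 2 + ∑ i, ‖partialDeriv i φ x‖ ^ 2
          + ∑ i, (x i) ^ 2 * ‖φ x‖ ^ 2) ∂gaussMeasure d 1 := by
          rw [← integral_gaussMeasure one_pos, integral_const_mul]
      _ ≤ (K⁻¹ * 3) * ((5 + 2 * d) * ‖w.1 + w.2‖ ^ 2) := by
          gcongr
          refine (integral_weighted_sobolev_le hφ1 h2).trans ?_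
          gcongr
      _ = _ := by ring
  rw [hv]
  have hK0 : 0 ≤ K⁻¹ * (3 * (5 + 2 * (d : ℝ))) := by positivity
  calc _ ≤ ENNReal.ofReal √(K⁻¹ * (3 * (5 + 2 * d)) * ‖w.1 + w.2‖ ^ 2) := by gcongr
    _ = ENNReal.ofReal (√(K⁻¹ * (3 * (5 + 2 * d))) * ‖w.1 + w.2‖) := by
        rw [Real.sqrt_mul hK0, Real.sqrt_sq (norm_nonneg _)]
    _ = _ := by
        rw [ENNReal.ofReal_mul (Real.sqrt_nonneg _), ofReal_norm]
        rfl

theorem exists_eLpNorm_gaussDensity_smul_eq (d : ℕ) {p : ℝ} (hp : 0 < p) :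
    ∃ C : ℝ≥0, ∀ f : EuclideanSpace ℝ (Fin d) → ℂ, AEStronglyMeasurable f volume →
      eLpNorm (fun x => gaussDensity d 2 x • f x) (ENNReal.ofReal p) volume
        = C * eLpNorm f (ENNReal.ofReal p) (gaussMeasure d (2 / p)) := by
  obtain ⟨K, hK, hKx⟩ := exists_gaussDensity_eq_const_mul_rpow d hp
  have hp0 : ENNReal.ofReal p ≠ 0 := by simpa using hp
  refine ⟨(Real.toNNReal K⁻¹) ^ (1 / p), fun f hf => ?_⟩
  rw [eLpNorm_eq_lintegral_rpow_enorm_toReal hp0 ENNReal.ofReal_ne_top,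
    eLpNorm_eq_lintegral_rpow_enorm_toReal hp0 ENNReal.ofReal_ne_top, ENNReal.toReal_ofReal hp.le,
    gaussMeasure_eq, lintegral_withDensity_eq_lintegral_mul₀
      (measurable_ofReal_gaussDensity d _).aemeasurable (hf.enorm.pow_const _),
    ENNReal.coe_rpow_of_nonneg _ (by positivity), ← ENNReal.mul_rpow_of_nonneg _ _ (by positivity),
    ← lintegral_const_mul' _ _ ENNReal.coe_ne_top]
  congr 2 with x
  have hg := gaussDensity_pos d (τ := 2) two_pos x
  rw [Pi.mul_apply, hKx, enorm_smul, ENNReal.mul_rpow_of_nonneg _ _ hp.le,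
    Real.enorm_of_nonneg hg.le, ENNReal.ofReal_rpow_of_pos hg, ← mul_assoc]
  congr 1
  change _ = ENNReal.ofReal K⁻¹ * _
  rw [← ENNReal.ofReal_mul (by positivity), inv_mul_cancel_left₀ hK.ne']

/-- The density of `γ_1` is shared equally between the two factors, one `ρ` each; what remains is
Hölder for Lebesgue measure. -/
theorem exists_lintegral_enorm_mul_le (d : ℕ) (p q : ℝ≥0∞) [p.HolderConjugate q] :
    ∃ C : ℝ≥0, ∀ f φ : EuclideanSpace ℝ (Fin d) → ℂ, AEStronglyMeasurable f volume →
      Continuous φ → ∫⁻ x, ‖f x‖ₑ * ‖φ x‖ₑ ∂gaussMeasure d 1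
        ≤ C * (eLpNorm (fun x => gaussDensity d 2 x • f x) p volume
          * eLpNorm (fun x => gaussDensity d 2 x • φ x) q volume) := by
  obtain ⟨K, hK, hKx⟩ := exists_gaussDensity_eq_const_mul_rpow d two_pos
  simp only [div_self (two_ne_zero (α := ℝ)), Real.rpow_ofNat] at hKx
  refine ⟨K.toNNReal, fun f φ hf hφ => ?_⟩
  have hg := continuous_gaussDensity d 2
  have h1 := eLpNorm_smul_le_mul_eLpNorm (p := p) (q := q) (r := 1) (μ := volume)
    (f := fun x => gaussDensity d 2 x • φ x) (φ := fun x => gaussDensity d 2 x • f x)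
    (hg.smul hφ).aestronglyMeasurable (hg.aestronglyMeasurable.smul hf)
  rw [eLpNorm_one_eq_lintegral_enorm] at h1
  rw [gaussMeasure_eq, lintegral_withDensity_eq_lintegral_mul₀
    (measurable_ofReal_gaussDensity d _).aemeasurable
    (show AEMeasurable (fun x => ‖f x‖ₑ * ‖φ x‖ₑ) volume from
      hf.enorm.mul hφ.enorm.measurable.aemeasurable)]
  refine le_trans (le_of_eq ?_) (mul_le_mul_right h1 _)
  rw [← lintegral_const_mul' _ _ ENNReal.coe_ne_top]
  congr 1 with x
  have hx := (gaussDensity_pos d (τ := 2) two_pos x).le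
  rw [Pi.mul_apply, hKx, Pi.smul_apply', enorm_smul, enorm_smul, enorm_smul,
    Real.enorm_of_nonneg hx, ENNReal.ofReal_mul hK.le, ENNReal.ofReal_pow hx]
  change ENNReal.ofReal K * _ * _ = ENNReal.ofReal K * _
  ring

/-- With `1/q = 1 - 1/p`, the claim `1/q > 1/2 - 1/d` is `1/p < 1/2 + 1/d = (d + 2)/(2d)`. -/
theorem exists_conjExponent_of_lt (hd : 1 ≤ d) {p : ℝ} (hp1 : 1 ≤ p)
    (hp : 2 * (d : ℝ) / ((d : ℝ) + 2) < p) (hp2 : p ≤ 2) :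
    ∃ q : ℝ≥0∞, (ENNReal.ofReal p).HolderConjugate q ∧ 2 ≤ q ∧
      1 / 2 < (q⁻¹).toReal + (d : ℝ)⁻¹ := by
  have hp0 : 0 < p := zero_lt_one.trans_le hp1
  have hd0 : (0 : ℝ) < d := by exact_mod_cast hd
  have hP1 : (ENNReal.ofReal p)⁻¹ ≤ 1 := by
    rw [ENNReal.inv_le_one]
    simpa using hp1
  have hqR : (1 - (ENNReal.ofReal p)⁻¹).toReal = 1 - p⁻¹ := by
    rw [ENNReal.toReal_sub_of_le hP1 ENNReal.one_ne_top, ENNReal.toReal_inv,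
      ENNReal.toReal_ofReal hp0.le, ENNReal.toReal_one]
  refine ⟨(1 - (ENNReal.ofReal p)⁻¹)⁻¹, ⟨?_⟩, ?_, ?_⟩
  · rw [inv_inv, add_tsub_cancel_of_le hP1, inv_one]
  · rw [← ENNReal.inv_le_inv, inv_inv, ← ENNReal.toReal_le_toReal
      (ENNReal.sub_ne_top ENNReal.one_ne_top) (by simp), hqR]
    simp only [ENNReal.toReal_inv, ENNReal.toReal_ofNat]
    have := inv_anti₀ hp0 hp2
    linarith
  · rw [inv_inv, hqR]
    rw [div_lt_iff₀ (by positivity)] at hp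
    have : p⁻¹ < 1 / 2 + (d : ℝ)⁻¹ := by
      rw [inv_eq_one_div, div_lt_iff₀ hp0]
      have h3 : (1 / 2 + (d : ℝ)⁻¹) * p = (p * (d + 2)) / (2 * d) := by field_simp
      rw [h3, lt_div_iff₀ (by positivity)]
      linarith
    linarith

theorem exists_enorm_inner_le (hd : 1 ≤ d) {p : ℝ} [hp1 : Fact (1 ≤ p)]
    (hp : 2 * (d : ℝ) / ((d : ℝ) + 2) < p) (hp2 : p ≤ 2) :
    ∃ C : ℝ≥0, ∀ w ∈ ouGraph d, ∀ (f : L2Gauss d) (g : LpGauss d p (2 / p)),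
      (f : EuclideanSpace ℝ (Fin d) → ℂ) =ᵐ[volume] g →
      ‖inner ℂ f w.1‖ₑ ≤ C * ‖g‖ₑ * ‖w.1 + w.2‖ₑ := by
  have hp0 : 0 < p := zero_lt_one.trans_le hp1.out
  obtain ⟨q, hPq, hq2, hqd⟩ := exists_conjExponent_of_lt hd hp1.out hp hp2
  obtain ⟨C1, hC1⟩ := exists_sobolev hd hq2 hqd
  obtain ⟨C2, hC2⟩ := exists_eLpNorm_sobolevDensity_le d
  obtain ⟨C3, hC3⟩ := exists_eLpNorm_gaussDensity_smul_eq d hp0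
  obtain ⟨C4, hC4⟩ := exists_lintegral_enorm_mul_le d (ENNReal.ofReal p) q
  refine ⟨C4 * C3 * C1 * C2, fun w hw f g hfg => ?_⟩
  obtain ⟨φ, h1, h2, h3, h4⟩ := hw
  have hf : AEStronglyMeasurable f volume :=
    (Lp.aestronglyMeasurable f).mono_ac (volume_absolutelyContinuous_gaussMeasure d one_pos)
  have hfg' : (f : EuclideanSpace ℝ (Fin d) → ℂ) =ᵐ[gaussMeasure d (2 / p)] g :=
    (gaussMeasure_absolutelyContinuous_volume d _).ae_eq hfg
  have e1 : eLpNorm f (ENNReal.ofReal p) (gaussMeasure d (2 / p)) = ‖g‖ₑ := by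
    rw [eLpNorm_congr_ae hfg', Lp.enorm_def]
  have hv : ContDiff ℝ 1 fun y => gaussDensity d 2 y • φ y :=
    (contDiff_gaussDensity d 2).smul (h1.of_le (by norm_num))
  have e2 := (hC1 _ hv (hasCompactSupport_gaussDensity_smul h2 2)).trans (mul_le_mul_right (hC2 φ h1 h2 w h3 h4) _)
  rw [L2Gauss.inner_eq_integral (Filter.EventuallyEq.refl _ _) h3]
  calc _ ≤ ∫⁻ x, ‖star ((f : EuclideanSpace ℝ (Fin d) → ℂ) x) * φ x‖ₑ ∂gaussMeasure d 1 :=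
        enorm_integral_le_lintegral_enorm _
    _ = ∫⁻ x, ‖(f : EuclideanSpace ℝ (Fin d) → ℂ) x‖ₑ * ‖φ x‖ₑ ∂gaussMeasure d 1 := by
        congr 1 with x
        rw [enorm_mul, ← ofReal_norm (star _), norm_star, ofReal_norm]
    _ ≤ C4 * ((C3 * ‖g‖ₑ) * (C1 * (C2 * ‖w.1 + w.2‖ₑ))) := by
        refine (hC4 f φ hf h1.continuous).trans ?_
        rw [hC3 f hf, e1]
        gcongr
    _ = _ := by
        push_cast
        ring

/-- For fixed `f` and `g` both sides are continuous in `w`, so the estimate on `C_c²` passes to the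
closure of the graph. -/
theorem exists_norm_inner_le (hd : 1 ≤ d) {p : ℝ} [hp1 : Fact (1 ≤ p)]
    (hp : 2 * (d : ℝ) / ((d : ℝ) + 2) < p) (hp2 : p ≤ 2) :
    ∃ C : ℝ, 0 ≤ C ∧ ∀ w ∈ (ouGraph d).topologicalClosure,
      ∀ (f : L2Gauss d) (g : LpGauss d p (2 / p)),
      (f : EuclideanSpace ℝ (Fin d) → ℂ) =ᵐ[volume] g →
      ‖inner ℂ f w.1‖ ≤ C * ‖g‖ * ‖w.1 + w.2‖ := by
  obtain ⟨C, hC⟩ := exists_enorm_inner_le hd hp hp2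
  refine ⟨C, C.2, fun w hw f g hfg => ?_⟩
  have hcl : IsClosed {w : L2Gauss d × L2Gauss d |
      ‖inner ℂ f w.1‖ ≤ C * ‖g‖ * ‖w.1 + w.2‖} :=
    isClosed_le (continuous_const.inner continuous_fst).norm
      (continuous_const.mul (continuous_fst.add continuous_snd).norm)
  refine closure_minimal (fun w hw => ?_) hcl hw
  have h := ENNReal.toReal_mono (ENNReal.mul_ne_top (ENNReal.mul_ne_top ENNReal.coe_ne_top
    enorm_ne_top) enorm_ne_top) (hC w hw f g hfg)
  rwa [ENNReal.toReal_mul, ENNReal.toReal_mul, ENNReal.coe_toReal, toReal_enorm, toReal_enorm,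
    toReal_enorm] at h

end Weighted

/-! ### The restricted Sobolev embedding -/

section Embedding

variable {d : ℕ}

theorem ae_eq_gaussMeasure_iff {τ : ℝ} (hτ : 0 < τ) {f g : EuclideanSpace ℝ (Fin d) → ℂ} :
    f =ᵐ[gaussMeasure d τ] g ↔ f =ᵐ[volume] g :=
  ⟨(volume_absolutelyContinuous_gaussMeasure d hτ).ae_eq,
    (gaussMeasure_absolutelyContinuous_volume d τ).ae_eq⟩

/-- The subspace `{(f, g) : f = g}` of `L²(γ) × L^p(γ_τ)`, i.e. `L²(γ) ∩ L^p(γ_τ)`. -/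
noncomputable def lpInter (d : ℕ) (p : ℝ) [Fact (1 ≤ p)] {τ : ℝ} (hτ : 0 < τ) :
    Submodule ℂ (L2Gauss d × LpGauss d p τ) where
  carrier := {w | (w.1 : EuclideanSpace ℝ (Fin d) → ℂ) =ᵐ[volume] w.2}
  zero_mem' :=
    ((ae_eq_gaussMeasure_iff one_pos).1 (Lp.coeFn_zero _ _ _)).trans
      ((ae_eq_gaussMeasure_iff hτ).1 (Lp.coeFn_zero _ _ _)).symm
  add_mem' {a b} ha hb :=
    ((ae_eq_gaussMeasure_iff one_pos).1 (Lp.coeFn_add a.1 b.1)).trans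
      ((Filter.EventuallyEq.add (show _ =ᵐ[volume] _ from ha) hb).trans ((ae_eq_gaussMeasure_iff hτ).1 (Lp.coeFn_add a.2 b.2)).symm)
  smul_mem' c a ha :=
    ((ae_eq_gaussMeasure_iff one_pos).1 (Lp.coeFn_smul c a.1)).trans
      ((Filter.EventuallyEq.const_smul (show _ =ᵐ[volume] _ from ha) c).trans ((ae_eq_gaussMeasure_iff hτ).1 (Lp.coeFn_smul c a.2)).symm)

/-- Simple functions are dense in `L^p(γ_τ)` and, `γ_1` being finite, they all belong to `L²(γ_1)`.
-/
theorem denseRange_lpInter_snd (p : ℝ) [Fact (1 ≤ p)] {τ : ℝ} (hτ : 0 < τ) :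
    DenseRange (LinearMap.snd ℂ (L2Gauss d) (LpGauss d p τ) ∘ₗ (lpInter d p hτ).subtype) := by
  refine (Lp.simpleFunc.denseRange (E := ℂ) (p := ENNReal.ofReal p) (μ := gaussMeasure d τ)
    ENNReal.ofReal_ne_top).mono ?_
  rintro _ ⟨g, rfl⟩
  let s := Lp.simpleFunc.toSimpleFunc g
  have hs : MemLp s 2 (gaussMeasure d 1) := s.memLp_of_isFiniteMeasure 2 _
  have h1 : (hs.toLp s : EuclideanSpace ℝ (Fin d) → ℂ) =ᵐ[volume] s :=
    (ae_eq_gaussMeasure_iff one_pos).1 hs.coeFn_toLp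
  have h2 : (s : EuclideanSpace ℝ (Fin d) → ℂ) =ᵐ[volume] (g : LpGauss d p τ) :=
    (ae_eq_gaussMeasure_iff hτ).1 (Lp.simpleFunc.toSimpleFunc_eq_toFun g)
  exact ⟨⟨(hs.toLp s, g), h1.trans h2⟩, rfl⟩

end Embedding

theorem mainTheorem7 (d : ℕ) (hd : 1 ≤ d) (p : ℝ) [Fact (1 ≤ p)]
    (hp : 2 * (d : ℝ) / ((d : ℝ) + 2) < p) (hp2 : p ≤ 2) :
    ∃ R : L2Gauss d →L[ℂ] L2Gauss d,
      IsResolventOneAdd (ornsteinUhlenbeck d) R ∧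
      ∃! S : LpGauss d p (2 / p) →L[ℂ] L2Gauss d,
        ∀ (f : L2Gauss d) (g : LpGauss d p (2 / p)),
          (f : EuclideanSpace ℝ (Fin d) → ℂ) =ᵐ[volume] g → S g = R f := by
  obtain ⟨R, hR, hRΓ⟩ := exists_resolvent_ornsteinUhlenbeck d
  obtain ⟨C, hC0, hC⟩ := exists_norm_inner_le hd hp hp2
  have hp0 : 0 < p := zero_lt_one.trans_le Fact.out
  have hτ : 0 < 2 / p := by positivity
  have hbound : ∀ (f : L2Gauss d) (g : LpGauss d p (2 / p)),
      (f : EuclideanSpace ℝ (Fin d) → ℂ) =ᵐ[volume] g → ‖R f‖ ≤ C * ‖g‖ := by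
    intro f g hfg
    -- Symmetry of `L` for the pairs `(R f, f - R f)` and `(R (R f), R f - R (R f))`; the term `⟪R
    -- f, R (R f)⟫` cancels from both sides.
    have h1 : inner ℂ f (R (R f)) = inner ℂ (R f) (R f) := by
      have h2 := closure_ouGraph_symm (hRΓ f) (hRΓ (R f))
      simp only [inner_sub_left, inner_sub_right] at h2
      exact (sub_left_inj.1 h2).symm
    -- The components of this graph element add up to `R f`, so the bound reads `‖R f‖² ≤ C ‖g‖ ‖R
    -- f‖`.
    have h3 := hC _ (hRΓ (R f)) f g hfg
    simp only [h1, add_sub_cancel] at h3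
    rw [inner_self_eq_norm_sq_to_K, norm_pow, RCLike.norm_ofReal, abs_norm, sq] at h3
    rcases (norm_nonneg (R f)).eq_or_lt with h4 | h4
    · rw [← h4]
      positivity
    · exact le_of_mul_le_mul_right h3 h4
  let e := LinearMap.snd ℂ (L2Gauss d) (LpGauss d p (2 / p)) ∘ₗ (lpInter d p hτ).subtype
  let T : lpInter d p hτ →ₗ[ℂ] L2Gauss d :=
    R.toLinearMap ∘ₗ LinearMap.fst ℂ (L2Gauss d) (LpGauss d p (2 / p)) ∘ₗ (lpInter d p hτ).subtype
  have he : DenseRange e := denseRange_lpInter_snd p hτ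
  have hTe : ∀ x, ‖T x‖ ≤ C * ‖e x‖ := fun x => hbound x.1.1 x.1.2 x.2
  refine ⟨R, hR, T.extendOfNorm e, fun f g hfg => ?_, fun S hS => ?_⟩
  · exact LinearMap.extendOfNorm_eq he ⟨C, hTe⟩ ⟨(f, g), hfg⟩
  · refine (LinearMap.extendOfNorm_unique he C hTe S ?_).symm
    ext1 x
    exact hS x.1.1 x.1.2 x.2
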